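/- Let $H$ be a real Hilbert space with norm $|\cdot|$ and inner product $(\cdot,\cdot)$, let $A:D(A)\subset H\to H$ be a closed, densely defined, self-adjoint, positive definite linear operator with compact resolvent, and let $\{\phi_j\}_{j\ge1}$ be an orthonormal basis of $H$ with $A\phi_j=\lambda_j\phi_j$, $\lambda_1\le\lambda_2\le\cdots$. Let $B\in\mathcal L(H)$, $\delta>0$, let $\beta:[0,\infty)\to\mathbb R$ be the solution of $\beta'+\delta\beta=0$, $\beta(0)=1$, and let $0<\gamma<\delta+1$. Put $\mu_j^{\pm}=\frac12\big(\lambda_j+\delta\pm\sqrt{(\lambda_j-\delta)^2-4\lambda_j}\big)$ (principal complex square root), let $N$ be the largest index $j$ with $\operatorname{Re}\mu_j^+\le\gamma$ or $\operatorname{Re}\mu_j^-\le\gamma$ ($N=0$ if there is none), and let $M$ be the largest multiplicity among the eigenvalues $\lambda_1,\dots,\lambda_N$ ($M=0$ if $N=0$). Define $$P=\begin{pmatrix}0&I_N\\-\operatorname{diag}(\lambda_j(1+\delta))&-\operatorname{diag}(\lambda_j+\delta)\end{pmatrix},\qquad Q=\begin{pmatrix}0\\ C_{NM}\end{pmatrix},\qquad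 (C_{NM})_{ji}=(B\phi_i,\phi_j),\ 1\le j\le N,\ 1\le i\le M .$$ Assume the following rank condition: there are an invertible complex $2N\times2N$ matrix $R$ and a matrix $J$ with $P=R^{-1}JR$, where $J$ is (up to the order of the basis) a direct sum of Jordan blocks and has diagonal $(-\mu_1^+,\dots,-\mu_N^+,-\mu_1^-,\dots,-\mu_N^-)$ (so $J$ is this diagonal matrix when the spectrum is semisimple), such that, with $\overline Q=RQ$, for every distinct eigenvalue $\lambda$ among $\lambda_1,\dots,\lambda_N$, of multiplicity $m$, the $M\times m$ matrix formed by the columns of $\overline Q^{*}$ with indices $\{j\le N:\lambda_j=\lambda\}$ has rank $m$, and the $M\times m$ matrix formed by the columns with indices $\{N+j: j\le N,\ \lambda_j=\lambda\}$ has rank $m$. Then there are $\psi_1,\dots,\psi_M\in\operatorname{span}\{\phi_1,\dots,\phi_M\}$, with $\psi_j=\phi_j$ for all $j$ if all eigenvalues $-\mu_j^\pm$ ($j\le N$) of $P$ are semisimple, and a constant $C>0$, such that for every $y_0\in H$ there is a real controller $$u^*(t)=\sum_{i=1}^{M}B\psi_i\,v_i^*(t)$$ with $v_j^*\in C^2([0,\infty);\mathbb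 R)$ and $$|v_j^*(t)|+|v_j^{*\prime}(t)|+|v_j^{*\prime\prime}(t)|\le Ce^{-\gamma t}|y_0|\qquad\forall\,t\ge0,\ j=1,\dots,M,$$ for which the system $$\frac{dy}{dt}+Ay(t)+\int_0^t\beta(t-s)Ay(s)\,ds=u^*(t),\quad t>0,\qquad y(0)=y_0,$$ has a unique weak solution $y^*$ in $C([0,\infty);H)$ (that is, $\frac{d}{dt}(y,w)+(y,Aw)+\int_0^t\beta(t-s)(y(s),Aw)\,ds=(u^*(t),w)$ for all $t>0$ and all $w\in D(A)$), and this solution satisfies $$y^*\in C^1((0,\infty);H)\cap L^2(0,T;D(A^{1/2}))\cap L^2_{loc}(0,\infty;D(A))\quad\forall\,T>0,\qquad |y^*(t)|\le Ce^{-\gamma t}|y_0|\quad\forall\,t\ge0 .$$ Here $L^2_{loc}(0,\infty;D(A))$ means $L^2(a,b;D(A))$ for all $0<a<b<\infty$. If moreover $y_0\in D(A)$, then $y^*\in C^1([0,T];H)$ for all $T>0$, $y^*\in C([0,\infty);D(A))$, and the equation holds in $H$ for all $t\ge0$. -/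

import Mathlib

open Set MeasureTheory
open scoped InnerProductSpace

noncomputable section

namespace PIDE

section Operator

variable {H : Type*} [NormedAddCommGroup H] [InnerProductSpace ℝ H]

/-- The unbounded operator `A` has compact resolvent: for some `r` in the resolvent set of `A`
the inverse `(r I - A)⁻¹ : H → D(A) ⊆ H` is a compact operator. -/
def HasCompactResolvent (A : H →ₗ.[ℝ] H) : Prop :=
  ∃ (r : ℝ) (T : H →L[ℝ] H), IsCompactOperator T ∧
    (∀ x : A.domain, T (r • (x : H) - A x) = x) ∧
    (∀ z : H, ∃ h : T z ∈ A.domain, r • T z - A ⟨T z, h⟩ = z)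

/-- The standing assumptions on `A : D(A) ⊆ H → H`: closed, densely defined, linear, self-adjoint,
positive definite, with compact resolvent. -/
structure IsAdmissible [CompleteSpace H] (A : H →ₗ.[ℝ] H) : Prop where
  dense : Dense (A.domain : Set H)
  closed : A.IsClosed
  selfAdjoint : IsSelfAdjoint A
  posDef : ∀ x : A.domain, (x : H) ≠ 0 → 0 < ⟪A x, (x : H)⟫_ℝ
  compactResolvent : HasCompactResolvent A

/-- `φ` is an orthonormal basis of `H` made of eigenvectors of `A`, and `lam` lists the
corresponding eigenvalues in nondecreasing order, repeated according to multiplicity.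
(Indices start at `0`: `φ j`, `lam j` are the `(j+1)`-st eigenvector and eigenvalue.) -/
structure IsEigenbasis (A : H →ₗ.[ℝ] H) (φ : HilbertBasis ℕ ℝ H) (lam : ℕ → ℝ) : Prop where
  mono : Monotone lam
  eigen : ∀ n, ∃ h : φ n ∈ A.domain, A ⟨φ n, h⟩ = lam n • φ n

/-- The fractional power `A ^ s`, for the operator `A` with eigenbasis `φ` and eigenvalues `lam`:
`A ^ s x = ∑ lam n ^ s (x, φ n) φ n`, with domain `{x | ∑ |lam n ^ s (x, φ n)|² < ∞}`. -/
def fracPow (φ : HilbertBasis ℕ ℝ H) (lam : ℕ → ℝ) (s : ℝ) : H →ₗ.[ℝ] H where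
  domain :=
    { carrier := {x | Memℓp (fun n => lam n ^ s * ⟪φ n, x⟫_ℝ) 2}
      add_mem' := by
        intro x z hx hz
        have h := Memℓp.add hx hz
        refine (congrArg (fun f => Memℓp f 2) ?_).mp h
        funext n
        simp [inner_add_right, mul_add]
      zero_mem' := by
        refine (congrArg (fun f => Memℓp f 2) ?_).mp (zero_memℓp (E := fun _ : ℕ => ℝ) (p := 2))
        funext n
        simp
      smul_mem' := by
        intro c x hx
        have h := Memℓp.const_smul (𝕜 := ℝ) hx c
        refine (congrArg (fun f => Memℓp f 2) ?_).mp h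
        funext n
        simp [inner_smul_right]
        ring }
  toFun :=
    { toFun := fun x => φ.repr.symm ⟨fun n => lam n ^ s * ⟪φ n, (x : H)⟫_ℝ, x.2⟩
      map_add' := by
        intro x z
        rw [← map_add]
        congr 1
        ext n
        simp [inner_add_right, mul_add]
        rfl
      map_smul' := by
        intro c x
        rw [RingHom.id_apply, ← map_smul]
        congr 1
        ext n
        simp [inner_smul_right]
        ring }

/-- `y ∈ L²(I; D(S))`, where `D(S)` carries the graph norm of the closed operator `S`:
`y ∈ L²(I; H)`, `y t ∈ D(S)` for almost every `t ∈ I`, and `S y ∈ L²(I; H)`. -/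
def MemL2Domain (S : H →ₗ.[ℝ] H) (I : Set ℝ) (y : ℝ → H) : Prop :=
  MemLp y 2 (volume.restrict I) ∧
    ∃ g : ℝ → H, MemLp g 2 (volume.restrict I) ∧
      ∀ᵐ t ∂(volume.restrict I), (y t, g t) ∈ S.graph

/-- `y` is the (weak) solution on `[0, ∞)` of
`y' + A y + ∫₀ᵗ β (t - s) A y(s) ds = f`, `y(0) = y₀`: it is continuous with values in `H` and
`d/dt (y, w) + (y, A w) + ∫₀ᵗ β (t - s) (y(s), A w) ds = (f, w)` for every `w ∈ D(A)`. -/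
structure IsWeakSolution (A : H →ₗ.[ℝ] H) (β : ℝ → ℝ) (f : ℝ → H) (y₀ : H) (y : ℝ → H) :
    Prop where
  cont : ContinuousOn y (Ici 0)
  init : y 0 = y₀
  eqn : ∀ w : A.domain, ∀ t : ℝ, 0 < t →
    HasDerivAt (fun r => ⟪y r, (w : H)⟫_ℝ)
      (⟪f t, (w : H)⟫_ℝ - ⟪y t, A w⟫_ℝ - ∫ s in (0 : ℝ)..t, β (t - s) * ⟪y s, A w⟫_ℝ) t

/-- `y` is a classical solution on `[0, ∞)` of
`y' + A y + ∫₀ᵗ β (t - s) A y(s) ds = f`, `y(0) = y₀`: it is continuous with values in `D(A)`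
(graph norm), continuously differentiable with values in `H` when `f` is continuous,
and the equation holds in `H` for all `t ≥ 0`. -/
structure IsClassicalSolution (A : H →ₗ.[ℝ] H) (β : ℝ → ℝ) (f : ℝ → H) (y₀ : H) (y : ℝ → H) :
    Prop where
  init : y 0 = y₀
  eqn : ∃ z : ℝ → H, ContinuousOn z (Ici 0) ∧ ∀ t : ℝ, 0 ≤ t →
    (y t, z t) ∈ A.graph ∧
    HasDerivWithinAt y (f t - z t - ∫ s in (0 : ℝ)..t, β (t - s) • z s) (Ici 0) t

end Operator

section Spectrum

/-- `μ⁺ = (l + δ + √((l - δ)² - 4 l)) / 2`, with the principal complex square root. -/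
def muPlus (δ l : ℝ) : ℂ :=
  (1 / 2 : ℂ) * ((l : ℂ) + δ + (((l : ℂ) - δ) ^ 2 - 4 * l) ^ (1 / 2 : ℂ))

/-- `μ⁻ = (l + δ - √((l - δ)² - 4 l)) / 2`, with the principal complex square root. -/
def muMinus (δ l : ℝ) : ℂ :=
  (1 / 2 : ℂ) * ((l : ℂ) + δ - (((l : ℂ) - δ) ^ 2 - 4 * l) ^ (1 / 2 : ℂ))

/-- `N = max {N₁, N₂}`, where `N₁` and `N₂` are the largest (one-based) indices `j` with
`Re μⱼ⁺ ≤ γ`, respectively `Re μⱼ⁻ ≤ γ` (and `0` if there is none). Both index sets are finite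
when `lam → ∞` and `γ < δ + 1`. -/
def unstableDim (δ γ : ℝ) (lam : ℕ → ℝ) : ℕ :=
  max (sSup ((fun j : ℕ => j + 1) '' {j | (muPlus δ (lam j)).re ≤ γ}))
    (sSup ((fun j : ℕ => j + 1) '' {j | (muMinus δ (lam j)).re ≤ γ}))

/-- The indices `j < N` whose eigenvalue is that of index `k`. -/
abbrev EigenGroup (lam : ℕ → ℝ) (N : ℕ) (k : Fin N) : Type :=
  {j : Fin N // lam j = lam k}

/-- The largest multiplicity `M` among the eigenvalues `lam 0, …, lam (N - 1)`. -/
def maxMult (lam : ℕ → ℝ) (N : ℕ) : ℕ :=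
  Finset.univ.sup fun k : Fin N => Fintype.card (EigenGroup lam N k)

/-- The `2N × 2N` matrix `P = [[0, I], [-B_N, -A_N]]` with `A_N = diag (lam j + δ)` and
`B_N = diag (lam j (1 + δ))`. -/
def matP (δ : ℝ) (lam : ℕ → ℝ) (N : ℕ) : Matrix (Fin N ⊕ Fin N) (Fin N ⊕ Fin N) ℂ :=
  Matrix.fromBlocks 0 1
    (-Matrix.diagonal fun j : Fin N => ((lam j * (1 + δ) : ℝ) : ℂ))
    (-Matrix.diagonal fun j : Fin N => ((lam j + δ : ℝ) : ℂ))

/-- The `2N × M` matrix `Q = [0 ; C]` with `C j i = (B φ i, φ j)`. -/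
def matQ {H : Type*} [NormedAddCommGroup H] [InnerProductSpace ℝ H]
    (B : H →L[ℝ] H) (φ : HilbertBasis ℕ ℝ H) (N M : ℕ) :
    Matrix (Fin N ⊕ Fin N) (Fin M) ℂ :=
  Matrix.fromRows 0 (Matrix.of fun (j : Fin N) (i : Fin M) => ((⟪B (φ i), φ j⟫_ℝ : ℝ) : ℂ))

/-- The Jordan block of size `n` with eigenvalue `c`. -/
def jordanBlock (c : ℂ) (n : ℕ) : Matrix (Fin n) (Fin n) ℂ :=
  Matrix.of fun a b => if a = b then c else if (a : ℕ) + 1 = b then 1 else 0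

/-- `J` is, up to the numbering of the basis, a direct sum of Jordan blocks. -/
def IsJordanMatrix {ι : Type*} (J : Matrix ι ι ℂ) : Prop :=
  ∃ (b : ℕ) (n : Fin b → ℕ) (c : Fin b → ℂ) (e : (Σ i : Fin b, Fin (n i)) ≃ ι),
    J = Matrix.reindex e e (Matrix.blockDiagonal' fun i => jordanBlock (c i) (n i))

/-- The eigenvalues `-μⱼ⁺, -μⱼ⁻` (`j < N`) of `P` are semisimple: every generalized eigenvector is
an eigenvector. -/
def IsSemisimpleSpectrum (δ : ℝ) (lam : ℕ → ℝ) (N : ℕ) : Prop :=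
  ∀ j : Fin N, ∀ r : ℂ, r = -muPlus δ (lam j) ∨ r = -muMinus δ (lam j) →
    Module.End.maxGenEigenspace (Matrix.toLin' (matP δ lam N)) r =
      Module.End.eigenspace (Matrix.toLin' (matP δ lam N)) r

/-- The rank condition. `R` brings `P` to a Jordan form `J = R P R⁻¹` with diagonal
`-μ₁⁺, …, -μ_N⁺, -μ₁⁻, …, -μ_N⁻` (when the spectrum is semisimple `J` is this diagonal matrix).
With `Q̄ = R Q`, for each eigenvalue `lam k`, of multiplicity `m`, the `m` columns of `Q̄*` that
belong to the `μ⁺` of this eigenvalue have rank `m`, and so have the `m` columns that belong to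
its `μ⁻`. -/
def RankCondition {H : Type*} [NormedAddCommGroup H] [InnerProductSpace ℝ H]
    (δ : ℝ) (B : H →L[ℝ] H) (φ : HilbertBasis ℕ ℝ H) (lam : ℕ → ℝ) (N M : ℕ) : Prop :=
  ∃ R J : Matrix (Fin N ⊕ Fin N) (Fin N ⊕ Fin N) ℂ,
    IsUnit R.det ∧ matP δ lam N = R⁻¹ * J * R ∧ IsJordanMatrix J ∧
    (∀ j : Fin N, J (Sum.inl j) (Sum.inl j) = -muPlus δ (lam j)) ∧
    (∀ j : Fin N, J (Sum.inr j) (Sum.inr j) = -muMinus δ (lam j)) ∧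
    ∀ k : Fin N,
      ((R * matQ B φ N M).conjTranspose.submatrix id
        (fun j : EigenGroup lam N k => Sum.inl (j : Fin N))).rank
          = Fintype.card (EigenGroup lam N k) ∧
      ((R * matQ B φ N M).conjTranspose.submatrix id
        (fun j : EigenGroup lam N k => Sum.inr (j : Fin N))).rank
          = Fintype.card (EigenGroup lam N k)

end Spectrum

end PIDE

end

/-! In the eigenbasis the equation decouples. Since `β t = exp (-δ t)`, the coordinate y of index n
and its convolution z with `β` solve y' = f - λ(y + z), z' = y - δz, with λ = `lam n`. Thus z solves
a scalar second order equation with characteristic polynomial X² + (λ + δ)X + λ(1 + δ), whose roots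
are `-muPlus` and `-muMinus` (`IsMode`).

The first `N` modes are steered exactly to zero. If R P = J R with J in Jordan form, each row of R
is a generalized left eigenvector of P, so it is supported on the indices of one eigenvalue
(`row_support`): distinct λ never share a characteristic root. The rank condition therefore makes
each block ((B φ i, φ j)) with `lam j` fixed surjective (`RankCondition.exists_rightInverse`).
Distinct λ also have coprime characteristic polynomials (`isCoprime_modePoly`), and a Bézout
identity between the corresponding differential operators gives smooth controls supported in [1, 2]
that bring one mode to rest by time 2 and leave all the others at rest at the end
(`exists_control`). Superposition gives `exists_nullControl`. The controls have compact support, so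
they and their derivatives decay at any rate, and ψ = φ works whether or not the spectrum is
semisimple.

The remaining modes decay at rate γ by themselves. For large λ the energy (y + z)² + (1 + δ)z² gives
constants independent of λ (`IsMode.decay`); this is where γ < 1 + δ enters. The finitely many
others are treated singly, by factoring the second order operator (`IsMode.exists_decay`).
Parseval's identity sums the coordinate bounds.

For regularity, λz is bounded uniformly and λy is bounded up to an initial layer λ exp(-(λ - 1)t)
(`IsMode.smoothing`). Curves in H are assembled from coordinates dominated by square summable
sequences (`exists_solution`). Uniqueness is that of each mode. -/

noncomputable section

namespace PIDE

open Filter Topology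
open scoped ContDiff

/-! ### The scalar modes: existence, uniqueness, decay and smoothing. -/

section Mode

/-- The two-dimensional system of a single eigenmode: `y' + l y + l z = f` and `z' = y - δ z`,
with `y 0 = a` and `z 0 = 0`, so that `z` is the convolution of `y` with `exp (-δ t)`. -/
structure IsMode (δ l : ℝ) (f : ℝ → ℝ) (a : ℝ) (y z : ℝ → ℝ) : Prop where
  init_fst : y 0 = a
  init_snd : z 0 = 0
  cont_fst : ContinuousOn y (Ici 0)
  cont_snd : ContinuousOn z (Ici 0)
  deriv_fst : ∀ t, 0 < t → HasDerivAt y (f t - l * (y t + z t)) t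
  deriv_snd : ∀ t, 0 < t → HasDerivAt z (y t - δ * z t) t

lemma muPlus_add_muMinus (δ l : ℝ) : muPlus δ l + muMinus δ l = l + δ := by
  unfold muPlus muMinus; ring

lemma muPlus_mul_muMinus (δ l : ℝ) : muPlus δ l * muMinus δ l = l * (1 + δ) := by
  have h : ((((l : ℂ) - δ) ^ 2 - 4 * l) ^ (1 / 2 : ℂ)) ^ 2 = ((l : ℂ) - δ) ^ 2 - 4 * l := by
    simp [one_div]
  unfold muPlus muMinus
  linear_combination (-1 / 4 : ℂ) * h

lemma muPlus_root (δ l : ℝ) : muPlus δ l ^ 2 - (l + δ) * muPlus δ l + l * (1 + δ) = 0 := by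
  linear_combination (muPlus δ l) * muPlus_add_muMinus δ l - muPlus_mul_muMinus δ l

lemma muMinus_root (δ l : ℝ) : muMinus δ l ^ 2 - (l + δ) * muMinus δ l + l * (1 + δ) = 0 := by
  linear_combination (muMinus δ l) * muPlus_add_muMinus δ l - muPlus_mul_muMinus δ l

/-- A root of the characteristic polynomial of a mode with large eigenvalue has large real part. -/
lemma lt_re_of_root {δ γ l : ℝ} (hδ : 0 < δ) (hγ : γ < δ + 1) (hl : γ + 1 ≤ l) {μ : ℂ}
    (h : μ ^ 2 - (l + δ) * μ + l * (1 + δ) = 0) : γ < μ.re := by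
  by_contra! hx
  have h1 := congrArg Complex.re h
  have h2 := congrArg Complex.im h
  simp only [pow_two, Complex.add_re, Complex.sub_re, Complex.mul_re, Complex.ofReal_re,
    Complex.ofReal_im, Complex.add_im, Complex.one_re, Complex.one_im, Complex.zero_re,
    Complex.sub_im, Complex.mul_im, Complex.zero_im] at h1 h2
  set x := μ.re
  set v := μ.im
  -- With w = 1 + δ - μ the equation reads μ - (l - 1) = (1 + δ) / w; this is its real part times
  -- |w|². If Re μ < 1 + δ the right side is positive, which forces Re μ > l - 1.
  have key : (x - (l - 1)) * ((1 + δ - x) ^ 2 + v ^ 2) = (1 + δ) * (1 + δ - x) := by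
    linear_combination (-(1 + δ - x)) * h1 + v * h2
  have : 0 < (1 + δ) * (1 + δ - x) := by apply mul_pos <;> linarith
  have : (x - (l - 1)) * ((1 + δ - x) ^ 2 + v ^ 2) ≤ 0 :=
    mul_nonpos_of_nonpos_of_nonneg (by linarith) (by positivity)
  linarith

lemma exists_firstOrder (μ x₀ : ℂ) {g : ℝ → ℂ} (hg : Continuous g) :
    ∃ x : ℝ → ℂ, x 0 = x₀ ∧ ∀ t, HasDerivAt x (g t - μ * x t) t := by
  refine ⟨fun t => Complex.exp (-(μ * t)) * (x₀ + ∫ s in (0 : ℝ)..t, Complex.exp (μ * s) * g s),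
    by simp, fun t => ?_⟩
  have hc : Continuous fun s : ℝ => Complex.exp (μ * s) * g s := by fun_prop
  have h1 := (hc.integral_hasStrictDerivAt 0 t).hasDerivAt.const_add x₀
  have h2 : HasDerivAt (fun t : ℝ => Complex.exp (-(μ * t))) (Complex.exp (-(μ * t)) * (-(μ * 1))) t :=
    (((Complex.ofRealCLM.hasDerivAt (x := t)).const_mul μ).neg).cexp
  refine (h2.mul h1).congr_deriv ?_
  have h3 : Complex.exp (-(μ * t)) * Complex.exp (μ * t) = 1 := by
    rw [← Complex.exp_add]; simp
  linear_combination (g t) * h3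

/-- The second order operator for z factors as (d/dt + μ⁻)(d/dt + μ⁺), so two scalar first order
equations are solved in turn: p for f, then q for p. Then z = q and y = z' + δz; real parts may be
taken since the coefficients and f are real. -/
lemma exists_mode_hasDerivAt (δ l : ℝ) {f : ℝ → ℝ} (hf : Continuous f) (a : ℝ) :
    ∃ y z : ℝ → ℝ, y 0 = a ∧ z 0 = 0 ∧ (∀ t, HasDerivAt y (f t - l * (y t + z t)) t) ∧
      ∀ t, HasDerivAt z (y t - δ * z t) t := by
  obtain ⟨p, hp0, hp⟩ := exists_firstOrder (muMinus δ l) a (g := fun t => (f t : ℂ)) (by fun_prop)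
  have hpc : Continuous p := continuous_iff_continuousAt.2 fun t => (hp t).continuousAt
  obtain ⟨q, hq0, hq⟩ := exists_firstOrder (muPlus δ l) 0 hpc
  have hr : ∀ {u : ℝ → ℂ} {u' : ℂ} {t : ℝ}, HasDerivAt u u' t →
      HasDerivAt (fun t => (u t).re) u'.re t := fun {u u' t} h => by
    exact Complex.reCLM.hasFDerivAt.comp_hasDerivAt t h
  have hs := muPlus_add_muMinus δ l
  have hm := muPlus_root δ l
  refine ⟨fun t => (p t + (δ - muPlus δ l) * q t).re, fun t => (q t).re, by simp [hp0, hq0],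
    by simp [hq0], fun t => ?_, fun t => ?_⟩
  · refine (hr ((hp t).add ((hq t).const_mul (δ - muPlus δ l)))).congr_deriv ?_
    have : (f t : ℂ) - muMinus δ l * p t + (δ - muPlus δ l) * (p t - muPlus δ l * q t)
        = (f t : ℂ) - l * (p t + (δ - muPlus δ l) * q t + q t) := by
      linear_combination (-p t) * hs + (q t) * hm
    rw [this]
    simp
  · refine (hr (hq t)).congr_deriv ?_
    have : p t - muPlus δ l * q t = (p t + (δ - muPlus δ l) * q t) - δ * q t := by ring
    rw [this]
    simp

lemma exists_mode (δ l : ℝ) {f : ℝ → ℝ} (hf : Continuous f) (a : ℝ) :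
    ∃ y z : ℝ → ℝ, IsMode δ l f a y z := by
  obtain ⟨y, z, h1, h2, h3, h4⟩ := exists_mode_hasDerivAt δ l hf a
  exact ⟨y, z, h1, h2, fun t _ => (h3 t).continuousAt.continuousWithinAt,
    fun t _ => (h4 t).continuousAt.continuousWithinAt, fun t _ => h3 t, fun t _ => h4 t⟩

lemma IsMode.sub {δ l : ℝ} {f f' : ℝ → ℝ} {a a' : ℝ} {y z y' z' : ℝ → ℝ}
    (h : IsMode δ l f a y z) (h' : IsMode δ l f' a' y' z') :
    IsMode δ l (f - f') (a - a') (y - y') (z - z') where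
  init_fst := by simp [h.init_fst, h'.init_fst]
  init_snd := by simp [h.init_snd, h'.init_snd]
  cont_fst := h.cont_fst.sub h'.cont_fst
  cont_snd := h.cont_snd.sub h'.cont_snd
  deriv_fst t ht := ((h.deriv_fst t ht).sub (h'.deriv_fst t ht)).congr_deriv (by simp; ring)
  deriv_snd t ht := ((h.deriv_snd t ht).sub (h'.deriv_snd t ht)).congr_deriv (by simp; ring)

lemma antitoneOn_Ici_of_hasDerivAt {F F' : ℝ → ℝ} (hc : ContinuousOn F (Ici 0))
    (hd : ∀ t, 0 < t → HasDerivAt F (F' t) t) (hF : ∀ t, 0 < t → F' t ≤ 0) :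
    AntitoneOn F (Ici 0) := by
  apply antitoneOn_of_deriv_nonpos (convex_Ici 0) hc
  · rw [interior_Ici]; exact fun t ht => (hd t ht).differentiableAt.differentiableWithinAt
  · rw [interior_Ici]; exact fun t ht => by rw [(hd t ht).deriv]; exact hF t ht

/-- The derivative of the weighted energy of a mode; the mixed terms cancel. -/
lemma IsMode.hasDerivAt_energy {δ l : ℝ} {f : ℝ → ℝ} {a : ℝ} {y z : ℝ → ℝ}
    (h : IsMode δ l f a y z) (c : ℝ) {t : ℝ} (ht : 0 < t) :
    HasDerivAt (fun t => Real.exp (c * t) * ((y t + z t) ^ 2 + (1 + δ) * z t ^ 2))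
      (Real.exp (c * t) * (c * ((y t + z t) ^ 2 + (1 + δ) * z t ^ 2)
        - 2 * (l - 1) * (y t + z t) ^ 2 + 2 * (y t + z t) * f t
        - 2 * (1 + δ) ^ 2 * z t ^ 2)) t := by
  have h1 : HasDerivAt (fun t => Real.exp (c * t)) (Real.exp (c * t) * (c * 1)) t :=
    ((hasDerivAt_id t).const_mul c).exp
  have h2 := ((h.deriv_fst t ht).add (h.deriv_snd t ht)).pow 2
  have h3 := ((h.deriv_snd t ht).pow 2).const_mul (1 + δ)
  refine (h1.mul (h2.add h3)).congr_deriv ?_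
  simp
  ring

lemma IsMode.continuousOn_energy {δ l : ℝ} {f : ℝ → ℝ} {a : ℝ} {y z : ℝ → ℝ}
    (h : IsMode δ l f a y z) (c : ℝ) :
    ContinuousOn (fun t => Real.exp (c * t) * ((y t + z t) ^ 2 + (1 + δ) * z t ^ 2)) (Ici 0) := by
  have := h.cont_fst
  have := h.cont_snd
  fun_prop

lemma IsMode.eq_zero {δ l : ℝ} (hδ : 0 < δ) (hl : 0 ≤ l) {f : ℝ → ℝ} {y z : ℝ → ℝ}
    (h : IsMode δ l f 0 y z) (hf : ∀ t, 0 < t → f t = 0) {t : ℝ} (ht : 0 ≤ t) :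
    y t = 0 ∧ z t = 0 := by
  -- For l < 1 the energy may grow, but at rate at most 2; the weight exp(-2t) absorbs this.
  have hanti := antitoneOn_Ici_of_hasDerivAt (h.continuousOn_energy (-2))
    (fun t ht => h.hasDerivAt_energy (-2) ht) (fun t ht => by
      rw [hf t ht]
      apply mul_nonpos_of_nonneg_of_nonpos (Real.exp_pos _).le
      nlinarith [mul_nonneg hl (sq_nonneg (y t + z t)), mul_nonneg hδ.le (sq_nonneg (z t)),
        sq_nonneg ((1 + δ) * z t), sq_nonneg (z t)])
  have h0 := hanti (mem_Ici.2 le_rfl) (mem_Ici.2 ht) ht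
  simp only [h.init_fst, h.init_snd] at h0
  norm_num at h0
  have h1 : (y t + z t) ^ 2 + (1 + δ) * z t ^ 2 ≤ 0 := by
    by_contra! hc
    exact absurd h0 (not_le.2 (mul_pos (Real.exp_pos _) hc))
  have hz : z t = 0 := by
    have : z t ^ 2 ≤ 0 := by nlinarith [sq_nonneg (y t + z t), sq_nonneg (z t)]
    exact pow_eq_zero_iff two_ne_zero |>.1 (le_antisymm this (sq_nonneg _))
  rw [hz] at h1
  refine ⟨?_, hz⟩
  have : y t ^ 2 ≤ 0 := by nlinarith
  exact pow_eq_zero_iff two_ne_zero |>.1 (le_antisymm this (sq_nonneg _))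

lemma IsMode.unique {δ l : ℝ} (hδ : 0 < δ) (hl : 0 ≤ l) {f : ℝ → ℝ} {a : ℝ} {y z y' z' : ℝ → ℝ}
    (h : IsMode δ l f a y z) (h' : IsMode δ l f a y' z') {t : ℝ} (ht : 0 ≤ t) :
    y t = y' t ∧ z t = z' t := by
  have h0 := h.sub h'
  rw [sub_self a] at h0
  have := h0.eq_zero hδ hl (fun t _ => by simp) ht
  exact ⟨sub_eq_zero.1 this.1, sub_eq_zero.1 this.2⟩

/-- Uniform exponential decay of the modes with large eigenvalue. -/
lemma IsMode.decay {δ γ l : ℝ} (hδ : 0 < δ) (hγ : γ < δ + 1) (hl : γ + 2 ≤ l)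
    {f : ℝ → ℝ} {a V : ℝ} (hV : 0 ≤ V) {y z : ℝ → ℝ} (h : IsMode δ l f a y z)
    (hf : ∀ t, 0 < t → |f t| ≤ V * Real.exp (-(γ + 1) * t)) {t : ℝ} (ht : 0 ≤ t) :
    |y t + z t| ≤ Real.exp (-γ * t) * (|a| + V) ∧ |z t| ≤ Real.exp (-γ * t) * (|a| + V) := by
  have hd : ∀ t : ℝ, HasDerivAt (fun t => V ^ 2 / 2 * Real.exp (-2 * t))
      (V ^ 2 / 2 * (Real.exp (-2 * t) * (-2 * 1))) t := fun t =>
    (((hasDerivAt_id t).const_mul (-2)).exp).const_mul _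
  -- The added term V²/2 · exp(-2t) has derivative -V² exp(-2t), which pays for the forcing:
  -- exp(2γt) f² ≤ V² exp(-2t). In `h3`, l ≥ γ + 2 absorbs the (y + z)² part of 2(y + z)f, and γ < 1
  -- + δ absorbs the z² terms.
  have hanti := antitoneOn_Ici_of_hasDerivAt
    ((h.continuousOn_energy (2 * γ)).add (f := fun t => Real.exp (2 * γ * t) *
      ((y t + z t) ^ 2 + (1 + δ) * z t ^ 2)) (g := fun t => V ^ 2 / 2 * Real.exp (-2 * t))
      (by fun_prop))
    (fun t ht => (h.hasDerivAt_energy (2 * γ) ht).add (hd t)) (fun t ht => by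
      have h1 : f t ^ 2 ≤ V ^ 2 * Real.exp (-2 * (γ + 1) * t) := by
        have := pow_le_pow_left₀ (abs_nonneg _) (hf t ht) 2
        rw [sq_abs, mul_pow, ← Real.exp_nat_mul] at this
        refine this.trans (le_of_eq ?_)
        congr 2; push_cast; ring
      have h2 : Real.exp (2 * γ * t) * f t ^ 2 ≤ V ^ 2 * Real.exp (-2 * t) := by
        have h3 := mul_le_mul_of_nonneg_left h1 (Real.exp_pos (2 * γ * t)).le
        refine h3.trans (le_of_eq ?_)
        rw [mul_left_comm, ← Real.exp_add]
        congr 2; ring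
      have h3 : 2 * γ * ((y t + z t) ^ 2 + (1 + δ) * z t ^ 2)
        - 2 * (l - 1) * (y t + z t) ^ 2 + 2 * (y t + z t) * f t
        - 2 * (1 + δ) ^ 2 * z t ^ 2 ≤ f t ^ 2 := by
        nlinarith [sq_nonneg (y t + z t - f t), mul_nonneg (sub_nonneg.2 hl) (sq_nonneg (y t + z t)),
          mul_nonneg (mul_nonneg (by linarith : 0 ≤ 1 + δ) (by linarith : 0 ≤ δ + 1 - γ))
            (sq_nonneg (z t)), sq_nonneg (y t + z t)]
      have h4 := mul_le_mul_of_nonneg_left h3 (Real.exp_pos (2 * γ * t)).le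
      linarith)
  have h0 := hanti (mem_Ici.2 le_rfl) (mem_Ici.2 ht) ht
  simp only [Pi.add_apply, h.init_fst, h.init_snd] at h0
  norm_num at h0
  have h1 : Real.exp (2 * γ * t) * ((y t + z t) ^ 2 + (1 + δ) * z t ^ 2) ≤ (|a| + V) ^ 2 := by
    have : 0 ≤ V ^ 2 / 2 * Real.exp (-(2 * t)) := by positivity
    nlinarith [sq_abs a, abs_nonneg a, mul_nonneg (abs_nonneg a) hV, sq_nonneg V]
  have h2 : Real.exp (-γ * t) ^ 2 * Real.exp (2 * γ * t) = 1 := by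
    rw [← Real.exp_nat_mul, ← Real.exp_add]; simp; ring
  have h3 : (y t + z t) ^ 2 + (1 + δ) * z t ^ 2 ≤ (Real.exp (-γ * t) * (|a| + V)) ^ 2 := by
    have := mul_le_mul_of_nonneg_left h1 (sq_nonneg (Real.exp (-γ * t)))
    rw [← mul_assoc, h2, one_mul] at this
    rwa [mul_pow]
  have h4 : 0 ≤ Real.exp (-γ * t) * (|a| + V) := by positivity
  have h5 := mul_nonneg hδ.le (sq_nonneg (z t))
  constructor <;> apply abs_le_of_sq_le_sq _ h4 <;>
    nlinarith [sq_nonneg (y t + z t), sq_nonneg (z t)]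

/-- The basic estimate for a first order linear equation. -/
lemma norm_le_of_firstOrder {μ : ℂ} {ρ G : ℝ} {x g : ℝ → ℂ} (hx : ContinuousOn x (Ici 0))
    (hgc : ContinuousOn g (Ici 0)) (hd : ∀ t, 0 < t → HasDerivAt x (g t - μ * x t) t)
    (hg : ∀ t, 0 < t → ‖g t‖ ≤ G * Real.exp (-ρ * t)) (hG : 0 ≤ G) (hρ : ρ < μ.re) {t : ℝ}
    (ht : 0 ≤ t) :
    ‖x t‖ ≤ Real.exp (-μ.re * t) * ‖x 0‖ + Real.exp (-ρ * t) * (G / (μ.re - ρ)) := by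
  have hpos : 0 < μ.re - ρ := sub_pos.2 hρ
  have he : ∀ s : ℝ, HasDerivAt (fun s : ℝ => Complex.exp (μ * s)) (Complex.exp (μ * s) * (μ * 1)) s :=
    fun s => ((Complex.ofRealCLM.hasDerivAt (x := s)).const_mul μ).cexp
  have hn : ∀ s : ℝ, ‖Complex.exp (μ * s)‖ = Real.exp (μ.re * s) := fun s => by
    rw [Complex.norm_exp]; simp
  have hint : IntervalIntegrable (fun s : ℝ => Complex.exp (μ * s) * g s) volume 0 t := by
    apply ContinuousOn.intervalIntegrable_of_Icc ht
    have := hgc.mono (Icc_subset_Ici_self : Icc 0 t ⊆ Ici 0)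
    fun_prop
  have h1 := intervalIntegral.integral_eq_sub_of_hasDerivAt_of_le
    (f := fun s : ℝ => Complex.exp (μ * s) * x s) (f' := fun s : ℝ => Complex.exp (μ * s) * g s) ht
    (by have := hx.mono (Icc_subset_Ici_self : Icc 0 t ⊆ Ici 0); fun_prop)
    (fun s hs => ((he s).mul (hd s hs.1)).congr_deriv (by ring)) hint
  have hG' : ∀ s : ℝ, HasDerivAt (fun s => G / (μ.re - ρ) * Real.exp ((μ.re - ρ) * s))
      (G * Real.exp ((μ.re - ρ) * s)) s := fun s => by
    refine ((((hasDerivAt_id s).const_mul (μ.re - ρ)).exp).const_mul _).congr_deriv ?_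
    simp only [id]
    field_simp
  have hGint : IntervalIntegrable (fun s => G * Real.exp ((μ.re - ρ) * s)) volume 0 t :=
    (by fun_prop : Continuous fun s => G * Real.exp ((μ.re - ρ) * s)).intervalIntegrable _ _
  have h2 : ‖∫ s in (0 : ℝ)..t, Complex.exp (μ * s) * g s‖
      ≤ ∫ s in (0 : ℝ)..t, G * Real.exp ((μ.re - ρ) * s) := by
    apply intervalIntegral.norm_integral_le_of_norm_le ht _ hGint
    refine Eventually.of_forall fun s hs => ?_
    rw [norm_mul, hn]
    have := mul_le_mul_of_nonneg_left (hg s hs.1) (Real.exp_pos (μ.re * s)).le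
    refine this.trans (le_of_eq ?_)
    rw [mul_left_comm, ← Real.exp_add]
    congr 2; ring
  rw [intervalIntegral.integral_eq_sub_of_hasDerivAt (fun s _ => hG' s) hGint] at h2
  have h3 : Complex.exp (μ * t) * x t = x 0 + ∫ s in (0 : ℝ)..t, Complex.exp (μ * s) * g s := by
    rw [h1]; simp
  have h4 : Real.exp (μ.re * t) * ‖x t‖ ≤ ‖x 0‖ + G / (μ.re - ρ) * Real.exp ((μ.re - ρ) * t) := by
    rw [← hn, ← norm_mul, h3]
    refine (norm_add_le _ _).trans (add_le_add_right (h2.trans ?_) _)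
    have : 0 ≤ G / (μ.re - ρ) * Real.exp ((μ.re - ρ) * 0) := by positivity
    linarith
  have h5 := mul_le_mul_of_nonneg_left h4 (Real.exp_pos (-μ.re * t)).le
  rw [← mul_assoc, ← Real.exp_add] at h5
  simp only [neg_mul, neg_add_cancel, Real.exp_zero, one_mul] at h5
  refine h5.trans (le_of_eq ?_)
  rw [mul_add, mul_left_comm, ← Real.exp_add]
  simp only [neg_mul]
  rw [show -(μ.re * t) + (μ.re - ρ) * t = -(ρ * t) by ring]
  ring

lemma abs_le_of_firstOrder {m ρ G : ℝ} {x g : ℝ → ℝ} (hx : ContinuousOn x (Ici 0))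
    (hgc : ContinuousOn g (Ici 0)) (hd : ∀ t, 0 < t → HasDerivAt x (g t - m * x t) t)
    (hg : ∀ t, 0 < t → |g t| ≤ G * Real.exp (-ρ * t)) (hG : 0 ≤ G) (hρ : ρ < m) {t : ℝ}
    (ht : 0 ≤ t) :
    |x t| ≤ Real.exp (-m * t) * |x 0| + Real.exp (-ρ * t) * (G / (m - ρ)) := by
  have := norm_le_of_firstOrder (μ := m) (x := fun t => (x t : ℂ)) (g := fun t => (g t : ℂ))
    (Complex.continuous_ofReal.comp_continuousOn hx)
    (Complex.continuous_ofReal.comp_continuousOn hgc)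
    (fun t ht => by simpa using (hd t ht).ofReal_comp)
    (fun t ht => by simpa using hg t ht) hG (by simpa using hρ) ht
  simpa using this

/-- Exponential decay of a mode both of whose characteristic exponents exceed `γ`. -/
lemma IsMode.exists_decay {δ γ l : ℝ} (hp : γ < (muPlus δ l).re) (hm : γ < (muMinus δ l).re) :
    ∃ C : ℝ, 0 ≤ C ∧ ∀ (f : ℝ → ℝ) (a V : ℝ) (y z : ℝ → ℝ), Continuous f → 0 ≤ V →
      IsMode δ l f a y z → (∀ t, 0 < t → |f t| ≤ V * Real.exp (-(γ + 1) * t)) →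
      ∀ t, 0 ≤ t → |y t| ≤ C * (Real.exp (-γ * t) * (|a| + V)) := by
  set p := muPlus δ l with hpdef
  set m := muMinus δ l with hmdef
  set c1 := 1 + 1 / (m.re - γ) with hc1
  have hm' : 0 < m.re - γ := sub_pos.2 hm
  have hp' : 0 < p.re - γ := sub_pos.2 hp
  have hc1' : 0 ≤ c1 := by positivity
  refine ⟨c1 + ‖(δ : ℂ) - p‖ * (c1 / (p.re - γ)), by positivity, ?_⟩
  intro f a V y z hfc hV h hf t ht
  -- u = z' + μ⁺z solves u' = f - μ⁻u, and then z' = u - μ⁺z. Nothing is divided by μ⁺ - μ⁻, so a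
  -- double root needs no separate treatment.
  set u : ℝ → ℂ := fun t => y t - δ * z t + p * z t with hu
  have hzc : ContinuousOn (fun t => (z t : ℂ)) (Ici 0) :=
    Complex.continuous_ofReal.comp_continuousOn h.cont_snd
  have hyc : ContinuousOn (fun t => (y t : ℂ)) (Ici 0) :=
    Complex.continuous_ofReal.comp_continuousOn h.cont_fst
  have huc : ContinuousOn u (Ici 0) := by fun_prop
  have hs : p + m = l + δ := muPlus_add_muMinus δ l
  have hr : p ^ 2 - (l + δ) * p + l * (1 + δ) = 0 := muPlus_root δ l
  have hub : ∀ t, 0 ≤ t → ‖u t‖ ≤ Real.exp (-γ * t) * (c1 * (|a| + V)) := by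
    intro t ht
    have := norm_le_of_firstOrder (μ := m) (ρ := γ) (G := V) (x := u) (g := fun t => (f t : ℂ)) huc
      (by fun_prop) (fun t ht => by
        refine ((((h.deriv_fst t ht).ofReal_comp).sub (((h.deriv_snd t ht).ofReal_comp).const_mul
          (δ : ℂ))).add (((h.deriv_snd t ht).ofReal_comp).const_mul p)).congr_deriv ?_
        simp only [hu]
        push_cast
        linear_combination (y t + (p - δ) * z t) * hs - (z t : ℂ) * hr)
      (fun t ht => by
        have h1 := hf t ht
        rw [Complex.norm_real, Real.norm_eq_abs]
        refine h1.trans (mul_le_mul_of_nonneg_left (Real.exp_le_exp.2 (by nlinarith)) hV)) hV hm ht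
    have h0 : ‖u 0‖ = |a| := by simp [hu, h.init_fst, h.init_snd]
    rw [h0] at this
    have h1 : Real.exp (-m.re * t) * |a| ≤ Real.exp (-γ * t) * |a| :=
      mul_le_mul_of_nonneg_right (Real.exp_le_exp.2 (by nlinarith)) (abs_nonneg _)
    have h2 : |a| + V / (m.re - γ) ≤ c1 * (|a| + V) := by
      have : 0 ≤ 1 / (m.re - γ) * |a| := by positivity
      rw [hc1, div_eq_mul_one_div V]
      nlinarith
    calc _ ≤ _ := this
      _ ≤ Real.exp (-γ * t) * (|a| + V / (m.re - γ)) := by linarith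
      _ ≤ _ := mul_le_mul_of_nonneg_left h2 (Real.exp_pos _).le
  have hzb : ‖(z t : ℂ)‖ ≤ Real.exp (-γ * t) * (c1 / (p.re - γ) * (|a| + V)) := by
    have := norm_le_of_firstOrder (μ := p) (ρ := γ) (G := c1 * (|a| + V))
      (x := fun t => (z t : ℂ)) (g := u) hzc huc (fun t ht => by
        refine ((h.deriv_snd t ht).ofReal_comp).congr_deriv ?_
        simp only [hu]
        push_cast
        ring)
      (fun t ht => by rw [mul_comm]; exact hub t ht.le) (by positivity) hp ht
    simp only [h.init_snd, Complex.ofReal_zero, norm_zero, mul_zero, zero_add] at this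
    refine this.trans (le_of_eq ?_)
    ring
  have hy : (y t : ℂ) = u t + (δ - p) * z t := by simp only [hu]; ring
  have : |y t| = ‖(y t : ℂ)‖ := by simp
  rw [this, hy]
  refine (norm_add_le _ _).trans ?_
  rw [norm_mul]
  have h1 := hub t ht
  have h2 := mul_le_mul_of_nonneg_left hzb (norm_nonneg ((δ : ℂ) - p))
  refine (add_le_add h1 h2).trans (le_of_eq ?_)
  ring

/-- Smoothing estimates for the modes with large eigenvalue. -/
lemma IsMode.smoothing {δ γ l : ℝ} (hδ : 0 < δ) (hγ0 : 0 < γ) (hγ : γ < δ + 1) (hl : γ + 2 ≤ l)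
    {f : ℝ → ℝ} (hfc : Continuous f) {a V : ℝ} (hV : 0 ≤ V) {y z : ℝ → ℝ}
    (h : IsMode δ l f a y z)
    (hf : ∀ t, 0 < t → |f t| ≤ V * Real.exp (-(γ + 1) * t)) {t : ℝ} (ht : 0 ≤ t) :
    l * |z t| ≤ 8 * (2 + δ) * (|a| + V) ∧
    l * |y t| ≤ l * Real.exp (-(l - 1) * t) * |a| + 12 * (2 + δ) * (|a| + V) := by
  have hl1 : 0 < l - 1 := by linarith
  set W := |a| + V with hW
  have hW0 : 0 ≤ W := by positivity
  have hVW : V ≤ W := by rw [hW]; linarith [abs_nonneg a]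
  have hexp : ∀ t : ℝ, 0 ≤ t → Real.exp (-γ * t) ≤ 1 := fun t ht => by
    rw [Real.exp_le_one_iff]; nlinarith
  have hfW : ∀ t, 0 < t → |f t| ≤ W := fun t ht => by
    refine (hf t ht).trans ?_
    have : Real.exp (-(γ + 1) * t) ≤ 1 := by rw [Real.exp_le_one_iff]; nlinarith
    nlinarith
  have hw : ∀ t, 0 ≤ t → |y t + z t| ≤ W := fun t ht =>
    ((h.decay hδ hγ hl hV hf ht).1).trans (mul_le_of_le_one_left hW0 (hexp t ht))
  have hz : ∀ t, 0 ≤ t → |z t| ≤ W := fun t ht =>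
    ((h.decay hδ hγ hl hV hf ht).2).trans (mul_le_of_le_one_left hW0 (hexp t ht))
  have hyc := h.cont_fst
  have hzc := h.cont_snd
  -- w = y + z solves w' = -(l - 1)w + f - (1 + δ)z with bounded forcing, hence is O(1/l) apart from
  -- its initial layer.
  have h1 := abs_le_of_firstOrder (m := l - 1) (ρ := 0) (G := (2 + δ) * W)
    (x := fun t => y t + z t) (g := fun t => f t - (1 + δ) * z t) (by fun_prop) (by fun_prop)
    (fun t ht => ((h.deriv_fst t ht).add (h.deriv_snd t ht)).congr_deriv (by ring))
    (fun t ht => by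
      have h2 := abs_sub (f t) ((1 + δ) * z t)
      rw [abs_mul, abs_of_pos (by linarith : 0 < 1 + δ)] at h2
      have h3 := mul_le_mul_of_nonneg_left (hz t ht.le) (by linarith : 0 ≤ 1 + δ)
      have h4 := hfW t ht
      simp only [neg_zero, zero_mul, Real.exp_zero, mul_one]
      linarith) (by positivity) hl1 ht
  -- In z + w/(l - 1) the coupling of z to w cancels: this slow variable decays at rate κ, which
  -- lies between 1 + δ and 2(1 + δ), under a forcing of size O(1/l). Hence z itself is O(1/l), with
  -- no initial layer.
  set κ := (1 + δ) * l / (l - 1) with hκ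
  have hκ0 : 1 + δ ≤ κ := by
    rw [hκ, le_div_iff₀ hl1]; nlinarith
  have hκ2 : κ ≤ 2 * (1 + δ) := by
    rw [hκ, div_le_iff₀ hl1]; nlinarith
  have h2 := abs_le_of_firstOrder (m := κ) (ρ := 0) (G := (κ * W + W) / (l - 1))
    (x := fun t => z t + (y t + z t) / (l - 1)) (g := fun t => (κ * (y t + z t) + f t) / (l - 1))
    (by fun_prop) (by fun_prop)
    (fun t ht => ((h.deriv_snd t ht).add (((h.deriv_fst t ht).add
      (h.deriv_snd t ht)).div_const (l - 1))).congr_deriv (by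
        rw [hκ]; field_simp; ring))
    (fun t ht => by
      simp only [neg_zero, zero_mul, Real.exp_zero, mul_one]
      rw [abs_div, abs_of_pos hl1]
      gcongr
      refine (abs_add_le _ _).trans ?_
      rw [abs_mul, abs_of_pos (by linarith : 0 < κ)]
      have := mul_le_mul_of_nonneg_left (hw t ht.le) (by linarith : 0 ≤ κ)
      linarith [hfW t ht])
    (by have : 0 ≤ κ := by linarith
        positivity) (by linarith) ht
  simp only [h.init_fst, h.init_snd, neg_zero, zero_mul, Real.exp_zero, one_mul, sub_zero, add_zero,
    zero_add] at h1 h2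
  have h3 : |z t| ≤ 4 * (2 + δ) * W / (l - 1) := by
    have e1 : Real.exp (-κ * t) * |a / (l - 1)| ≤ W / (l - 1) := by
      rw [abs_div, abs_of_pos hl1]
      have : Real.exp (-κ * t) ≤ 1 := by rw [Real.exp_le_one_iff]; nlinarith
      have h5 : |a| / (l - 1) ≤ W / (l - 1) := by gcongr; rw [hW]; linarith
      exact (mul_le_of_le_one_left (by positivity) this).trans h5
    have e2 : (κ * W + W) / (l - 1) / κ ≤ 2 * W / (l - 1) := by
      rw [div_div, div_le_div_iff₀ (by have : 0 < κ := by linarith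
                                       positivity) hl1]
      have : (κ * W + W) ≤ 2 * W * κ := by nlinarith
      nlinarith [mul_le_mul_of_nonneg_right this hl1.le]
    have e3 : |(y t + z t) / (l - 1)| ≤ W / (l - 1) := by
      rw [abs_div, abs_of_pos hl1]; gcongr; exact hw t ht
    have e4 : |z t| ≤ |z t + (y t + z t) / (l - 1)| + |(y t + z t) / (l - 1)| := by
      have := abs_sub (z t + (y t + z t) / (l - 1)) ((y t + z t) / (l - 1))
      simpa using this
    have e5 : W / (l - 1) + 2 * W / (l - 1) + W / (l - 1) ≤ 4 * (2 + δ) * W / (l - 1) := by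
      rw [← add_div, ← add_div]; gcongr; nlinarith
    linarith
  have hl2 : l ≤ 2 * (l - 1) := by linarith
  have h4 : l * |z t| ≤ 8 * (2 + δ) * W := by
    have := mul_le_mul_of_nonneg_left h3 (by linarith : 0 ≤ l)
    refine this.trans ?_
    rw [mul_div_assoc', div_le_iff₀ hl1]
    nlinarith [mul_nonneg (by linarith : 0 ≤ 2 + δ) hW0]
  refine ⟨h4, ?_⟩
  have h5 : l * |y t + z t| ≤ l * Real.exp (-(l - 1) * t) * |a| + 2 * (2 + δ) * W := by
    have := mul_le_mul_of_nonneg_left h1 (by linarith : 0 ≤ l)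
    refine this.trans ?_
    rw [mul_add, ← mul_assoc]
    refine add_le_add_right ?_ _
    rw [mul_div_assoc', div_le_iff₀ hl1]
    nlinarith [mul_nonneg (by linarith : 0 ≤ 2 + δ) hW0]
  have h6 : |y t| ≤ |y t + z t| + |z t| := by
    simpa using abs_sub (y t + z t) (z t)
  have h7 := mul_le_mul_of_nonneg_left h6 (by linarith : 0 ≤ l)
  nlinarith [mul_nonneg (by linarith : 0 ≤ 2 + δ) hW0]

end Mode

/-! ### Vector-valued curves through their coordinates in the basis. -/

section Coordinates

variable {H : Type*} [NormedAddCommGroup H] [InnerProductSpace ℝ H]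

lemma ext_coord (φ : HilbertBasis ℕ ℝ H) {x y : H} (h : ∀ n, ⟪φ n, x⟫_ℝ = ⟪φ n, y⟫_ℝ) : x = y := by
  apply φ.repr.injective
  ext n
  rw [φ.repr_apply_apply, φ.repr_apply_apply, h]

lemma exists_coord (φ : HilbertBasis ℕ ℝ H) {c : ℕ → ℝ} (hc : Summable fun n => c n ^ 2) :
    ∃ x : H, ∀ n, ⟪φ n, x⟫_ℝ = c n := by
  have hm : Memℓp c 2 := memℓp_gen (by simpa using hc)
  refine ⟨φ.repr.symm ⟨c, hm⟩, fun n => ?_⟩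
  rw [← φ.repr_apply_apply, LinearIsometryEquiv.apply_symm_apply]

lemma hasSum_coord_sq [CompleteSpace H] (φ : HilbertBasis ℕ ℝ H) (x : H) :
    HasSum (fun n => ⟪φ n, x⟫_ℝ ^ 2) (‖x‖ ^ 2) := by
  have := φ.hasSum_inner_mul_inner x x
  rw [real_inner_self_eq_norm_sq] at this
  refine this.congr_fun ?_ |> id
  intro n
  rw [real_inner_comm x, pow_two]

/-- Continuity of a vector-valued map with continuous coordinates, almost all of which are
dominated by a square summable sequence. -/
lemma continuousOn_of_coord [CompleteSpace H] (φ : HilbertBasis ℕ ℝ H) {Y : ℝ → H} {S : Set ℝ}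
    (hc : ∀ n, ContinuousOn (fun t => ⟪φ n, Y t⟫_ℝ) S) {G : ℕ → ℝ}
    (hG : Summable fun n => G n ^ 2) (hb : ∀ᶠ n in atTop, ∀ t ∈ S, |⟪φ n, Y t⟫_ℝ| ≤ G n) :
    ContinuousOn Y S := by
  intro s hs
  obtain ⟨J, hJ⟩ := eventually_atTop.1 hb
  have hlim : ∀ n, Tendsto (fun t => ⟪φ n, Y t - Y s⟫_ℝ ^ 2) (𝓝[S] s) (𝓝 0) := fun n => by
    have h1 : Tendsto (fun t => (⟪φ n, Y t⟫_ℝ - ⟪φ n, Y s⟫_ℝ) ^ 2) (𝓝[S] s)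
        (𝓝 ((⟪φ n, Y s⟫_ℝ - ⟪φ n, Y s⟫_ℝ) ^ 2)) :=
      ((hc n s hs).tendsto.sub tendsto_const_nhds).pow 2
    simpa [inner_sub_right] using h1
  -- The finitely many coordinates without an assumed bound are dominated by 1 near s, by their own
  -- continuity.
  have hsum : Summable fun n => if n < J then (1 : ℝ) else 4 * G n ^ 2 := by
    rw [← summable_nat_add_iff J]
    simpa using ((summable_nat_add_iff J).2 hG).mul_left 4
  have hlow : ∀ᶠ t in 𝓝[S] s, ∀ n < J, ⟪φ n, Y t - Y s⟫_ℝ ^ 2 ≤ 1 := by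
    have : ∀ᶠ t in 𝓝[S] s, ∀ n ∈ Finset.range J, ⟪φ n, Y t - Y s⟫_ℝ ^ 2 ≤ 1 := by
      rw [Filter.eventually_all_finset]
      intro n _
      exact (hlim n).eventually (eventually_le_nhds one_pos)
    filter_upwards [this] with t ht n hn using ht n (Finset.mem_range.2 hn)
  have key := tendsto_tsum_of_dominated_convergence hsum hlim (by
    filter_upwards [hlow, self_mem_nhdsWithin] with t ht htS n
    rw [Real.norm_eq_abs, abs_of_nonneg (sq_nonneg _)]
    split_ifs with h
    · exact ht n h
    · have h1 := hJ n (not_lt.1 h) t htS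
      have h2 := hJ n (not_lt.1 h) s hs
      rw [inner_sub_right]
      have h3 : |⟪φ n, Y t⟫_ℝ - ⟪φ n, Y s⟫_ℝ| ≤ 2 * G n := (abs_sub _ _).trans (by linarith)
      have h4 := pow_le_pow_left₀ (abs_nonneg _) h3 2
      rw [sq_abs] at h4
      linarith)
  simp only [tsum_zero, (hasSum_coord_sq φ _).tsum_eq] at key
  have h2 := (Real.continuous_sqrt.tendsto 0).comp key
  rw [ContinuousWithinAt, tendsto_iff_norm_sub_tendsto_zero]
  simpa [Function.comp_def, Real.sqrt_sq] using h2

/-- Differentiability of a vector-valued map from that of its coordinates. -/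
lemma hasDerivWithinAt_of_coord [CompleteSpace H] (φ : HilbertBasis ℕ ℝ H) {Y Z : ℝ → H} {a : ℝ}
    (hc : ∀ n, ContinuousOn (fun t => ⟪φ n, Y t⟫_ℝ) (Ici a)) (hZ : ContinuousOn Z (Ici a))
    (hd : ∀ n t, a < t → HasDerivAt (fun t => ⟪φ n, Y t⟫_ℝ) ⟪φ n, Z t⟫_ℝ t) {t : ℝ} (ht : a ≤ t) :
    HasDerivWithinAt Y (Z t) (Ici a) t := by
  -- Freezing Z to the left of a makes it continuous on the line, so that Y can be compared,
  -- coordinate by coordinate, with Y(a) + ∫ Z.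
  have hZc : Continuous fun t => Z (max t a) :=
    hZ.comp_continuous (by fun_prop) fun t => mem_Ici.2 (le_max_right _ _)
  have h1 := (hZc.integral_hasStrictDerivAt a t).hasDerivAt.const_add (Y a)
  rw [max_eq_left ht] at h1
  refine h1.hasDerivWithinAt.congr_of_mem (fun s hs => ?_) ht
  apply ext_coord φ
  intro n
  have h2 := (innerSL ℝ (φ n)).intervalIntegral_comp_comm (hZc.intervalIntegrable (μ := volume) a s)
  simp only [innerSL_apply_apply] at h2
  rw [inner_add_right, ← h2]
  have hs' : a ≤ s := hs
  have hcn : Continuous fun t => ⟪φ n, Z (max t a)⟫_ℝ := continuous_const.inner hZc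
  have h3 := intervalIntegral.integral_eq_sub_of_hasDerivAt_of_le hs'
    ((hc n).mono Icc_subset_Ici_self) (f' := fun t => ⟪φ n, Z (max t a)⟫_ℝ)
    (fun t ht => by rw [max_eq_left ht.1.le]; exact hd n t ht.1) (hcn.intervalIntegrable _ _)
  rw [h3]
  ring

lemma fracPow_graph_of_coord {φ : HilbertBasis ℕ ℝ H} {lam : ℕ → ℝ} {s : ℝ} {x g : H} (h : ∀ n, ⟪φ n, g⟫_ℝ = lam n ^ s * ⟪φ n, x⟫_ℝ) :
    (x, g) ∈ (fracPow φ lam s).graph := by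
  have hm : Memℓp (fun n => lam n ^ s * ⟪φ n, x⟫_ℝ) 2 := by
    have he : (fun n => lam n ^ s * ⟪φ n, x⟫_ℝ) = ⇑(φ.repr g) := by
      funext n
      rw [φ.repr_apply_apply, h]
    exact (congrArg (fun f => Memℓp f 2) he).mpr (lp.memℓp (φ.repr g))
  rw [LinearPMap.mem_graph_iff]
  refine ⟨⟨x, hm⟩, rfl, ?_⟩
  apply φ.repr.injective
  ext n
  change _ = (φ.repr g) n
  rw [φ.repr_apply_apply g, h]
  change (φ.repr (φ.repr.symm ⟨fun n => lam n ^ s * ⟪φ n, x⟫_ℝ, hm⟩)) n = _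
  rw [LinearIsometryEquiv.apply_symm_apply]

end Coordinates

/-! ### The operator in its eigenbasis, and the kernel. -/

section Operator

variable {H : Type*} [NormedAddCommGroup H] [InnerProductSpace ℝ H] [CompleteSpace H]
  {A : H →ₗ.[ℝ] H} {φ : HilbertBasis ℕ ℝ H} {lam : ℕ → ℝ}

lemma inner_apply_eq (hA : IsAdmissible A) (x w : A.domain) :
    ⟪A x, (w : H)⟫_ℝ = ⟪(x : H), A w⟫_ℝ := by
  have h1 := LinearPMap.adjoint_isFormalAdjoint (T := A) hA.dense
  rw [LinearPMap.isSelfAdjoint_def.1 hA.selfAdjoint] at h1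
  exact h1 x w

lemma coord_apply (hA : IsAdmissible A) (hφ : IsEigenbasis A φ lam) (w : A.domain) (n : ℕ) :
    ⟪φ n, A w⟫_ℝ = lam n * ⟪φ n, (w : H)⟫_ℝ := by
  obtain ⟨h, he⟩ := hφ.eigen n
  have := inner_apply_eq hA ⟨φ n, h⟩ w
  rw [he, real_inner_smul_left] at this
  exact this.symm

lemma lam_pos (hA : IsAdmissible A) (hφ : IsEigenbasis A φ lam) (n : ℕ) : 0 < lam n := by
  obtain ⟨h, he⟩ := hφ.eigen n
  have h1 : ‖φ n‖ = 1 := φ.orthonormal.1 n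
  have := hA.posDef ⟨φ n, h⟩ (by rw [← norm_ne_zero_iff, h1]; exact one_ne_zero)
  rw [he, real_inner_smul_left, real_inner_self_eq_norm_sq, h1] at this
  simpa using this

/-- This is closedness of `A`: the partial sums of the expansions of x and g are points of the graph
converging to (x, g). -/
lemma graph_of_coord (hA : IsAdmissible A) (hφ : IsEigenbasis A φ lam) {x g : H}
    (h : ∀ n, ⟪φ n, g⟫_ℝ = lam n * ⟪φ n, x⟫_ℝ) : (x, g) ∈ A.graph := by
  have hx := φ.hasSum_repr x
  have hg := φ.hasSum_repr g
  have hs := hx.prodMk hg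
  refine IsClosed.mem_of_tendsto (s := (A.graph : Set (H × H))) hA.closed hs
    (Eventually.of_forall fun s => ?_)
  refine Submodule.sum_mem _ fun n _ => ?_
  obtain ⟨hn, he⟩ := hφ.eigen n
  rw [φ.repr_apply_apply, φ.repr_apply_apply, h]
  have h1 : (φ n, lam n • φ n) ∈ A.graph := by
    rw [← he]; exact A.mem_graph ⟨φ n, hn⟩
  have h2 := A.graph.smul_mem ⟪φ n, x⟫_ℝ h1
  rw [Prod.smul_mk, smul_smul, mul_comm] at h2
  exact h2

/-- T acts on `φ n` as (r - `lam n`)⁻¹. Were the eigenvalues bounded, the images of the basis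
vectors would keep a mutual distance bounded below, against compactness. -/
lemma tendsto_lam (hA : IsAdmissible A) (hφ : IsEigenbasis A φ lam) : Tendsto lam atTop atTop := by
  rcases tendsto_atTop_of_monotone hφ.mono with h | ⟨L, hL⟩
  · exact h
  exfalso
  have hle : ∀ n, lam n ≤ L := hφ.mono.ge_of_tendsto hL
  obtain ⟨r, T, hT, hTl, -⟩ := hA.compactResolvent
  have hTφ : ∀ n, (r - lam n) • T (φ n) = φ n := fun n => by
    obtain ⟨hn, he⟩ := hφ.eigen n
    have := hTl ⟨φ n, hn⟩
    rw [he, ← sub_smul, map_smul] at this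
    exact this
  have hbound : ∀ n, |r - lam n| ≤ |r| + L := fun n => by
    have := abs_sub r (lam n)
    rw [abs_of_pos (lam_pos hA hφ n)] at this
    linarith [hle n]
  obtain ⟨K, hK, hKn⟩ := hT
  obtain ⟨ε, hε, hball⟩ := Metric.mem_nhds_iff.1 hKn
  have hmem : ∀ n, T ((ε / 2) • φ n) ∈ K := fun n => by
    refine hball ?_
    rw [mem_ball_zero_iff, norm_smul, φ.orthonormal.1 n, mul_one, Real.norm_eq_abs,
      abs_of_pos (half_pos hε)]
    exact half_lt_self hε
  obtain ⟨x, -, u, hu, hx⟩ := hK.tendsto_subseq hmem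
  have hu' := hu.tendsto_atTop
  have hcauchy := hx.cauchySeq
  have hlow : ∀ m n, m ≠ n → ε / 2 ≤ (|r| + L) * ‖T ((ε / 2) • φ m) - T ((ε / 2) • φ n)‖ := by
    intro m n hmn
    have e1 : ⟪φ m, T ((ε / 2) • φ m) - T ((ε / 2) • φ n)⟫_ℝ * (r - lam m) = ε / 2 := by
      have hn0 : r - lam n ≠ 0 := fun h0 => by
        have := hTφ n
        rw [h0, zero_smul] at this
        exact φ.orthonormal.ne_zero n this.symm
      have e2 : T (φ n) = (r - lam n)⁻¹ • φ n := by
        rw [eq_inv_smul_iff₀ hn0]; exact hTφ n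
      have hm0 : r - lam m ≠ 0 := fun h0 => by
        have := hTφ m
        rw [h0, zero_smul] at this
        exact φ.orthonormal.ne_zero m this.symm
      have e3 : T (φ m) = (r - lam m)⁻¹ • φ m := by
        rw [eq_inv_smul_iff₀ hm0]; exact hTφ m
      rw [map_smul, map_smul, e2, e3, inner_sub_right, inner_smul_right, inner_smul_right,
        inner_smul_right, inner_smul_right, φ.orthonormal.2 hmn, real_inner_self_eq_norm_sq,
        φ.orthonormal.1 m]
      field_simp
      ring
    have e4 := abs_real_inner_le_norm (φ m) (T ((ε / 2) • φ m) - T ((ε / 2) • φ n))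
    rw [φ.orthonormal.1 m, one_mul] at e4
    have e5 := congrArg abs e1
    rw [abs_mul, abs_of_pos (half_pos hε)] at e5
    refine e5.symm.le.trans ?_
    rw [mul_comm (|r| + L)]
    exact mul_le_mul e4 (hbound m) (abs_nonneg _) (norm_nonneg _)
  have hL0 : 0 < |r| + L := by
    have := (lam_pos hA hφ 0).trans_le (hle 0)
    positivity
  obtain ⟨n₀, hn₀⟩ := Metric.cauchySeq_iff.1 hcauchy (ε / 2 / (|r| + L)) (by positivity)
  have h1 := hn₀ n₀ le_rfl (n₀ + 1) (by omega)
  rw [dist_eq_norm, lt_div_iff₀ hL0, mul_comm] at h1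
  exact absurd h1 (not_lt.2 (hlow _ _ (hu.injective.ne (by omega))))

lemma eqOn_exp_of_hasDerivAt {δ : ℝ} {β : ℝ → ℝ} (hβ0 : β 0 = 1) (hβc : ContinuousOn β (Ici 0))
    (hβ : ∀ t : ℝ, 0 < t → HasDerivAt β (-(δ * β t)) t) {t : ℝ} (ht : 0 ≤ t) :
    β t = Real.exp (-δ * t) := by
  have h1 := intervalIntegral.integral_eq_sub_of_hasDerivAt_of_le (a := 0) (b := t)
    (f := fun s => Real.exp (δ * s) * β s) (f' := fun _ => 0) ht
    (by have := hβc.mono (Icc_subset_Ici_self : Icc 0 t ⊆ Ici 0); fun_prop)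
    (fun s hs => ((((hasDerivAt_id s).const_mul δ).exp).mul (hβ s hs.1)).congr_deriv
      (by simp only [id]; ring))
    (by simp)
  simp only [intervalIntegral.integral_zero, mul_zero, Real.exp_zero, hβ0, mul_one] at h1
  have h2 : Real.exp (-δ * t) * Real.exp (δ * t) = 1 := by rw [← Real.exp_add]; simp
  linear_combination (-Real.exp (-δ * t)) * h1 - β t * h2

end Operator

/-! ### From the rank condition to right inverses of the control blocks. -/

section Rank

/-- Subtracting the equations gives (l - k)(1 + δ - μ) = 0, and at μ = 1 + δ the polynomial takes
the value 1 + δ ≠ 0, whatever l is. -/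
lemma eq_of_common_root {δ l k : ℝ} (hδ : 0 < δ) {μ : ℂ}
    (hl : μ ^ 2 - (l + δ) * μ + l * (1 + δ) = 0) (hk : μ ^ 2 - (k + δ) * μ + k * (1 + δ) = 0) :
    l = k := by
  have h1 : ((l : ℂ) - k) * (1 + δ - μ) = 0 := by linear_combination hl - hk
  rcases mul_eq_zero.1 h1 with h | h
  · exact_mod_cast sub_eq_zero.1 h
  · have h2 : (1 : ℂ) + δ = 0 := by linear_combination hk + (μ - k + 1 : ℂ) * h
    have h3 : (1 : ℝ) + δ = 0 := by exact_mod_cast h2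
    linarith

lemma mul_matP_inl {ι : Type*} (R : Matrix ι (Fin N ⊕ Fin N) ℂ) (δ : ℝ) (lam : ℕ → ℝ) (r : ι)
    (l : Fin N) :
    (R * matP δ lam N) r (Sum.inl l) = -(lam l * (1 + δ) * R r (Sum.inr l)) := by
  simp [matP, Matrix.mul_apply, Matrix.fromBlocks, Matrix.diagonal_apply, mul_comm]

lemma mul_matP_inr {ι : Type*} (R : Matrix ι (Fin N ⊕ Fin N) ℂ) (δ : ℝ) (lam : ℕ → ℝ) (r : ι)
    (l : Fin N) :
    (R * matP δ lam N) r (Sum.inr l)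
      = R r (Sum.inl l) - (lam l + δ) * R r (Sum.inr l) := by
  simp [matP, Matrix.mul_apply, Matrix.fromBlocks, Matrix.diagonal_apply, Matrix.one_apply,
    mul_comm, sub_eq_add_neg]
  ring

/-- The rows of a matrix that transforms `P` to Jordan form are generalized left eigenvectors of
`P`, hence supported on the indices of a single eigenvalue. -/
lemma row_support {δ : ℝ} {lam : ℕ → ℝ} {N : ℕ} {R J : Matrix (Fin N ⊕ Fin N) (Fin N ⊕ Fin N) ℂ}
    (hRP : R * matP δ lam N = J * R) (hJ : IsJordanMatrix J) (r : Fin N ⊕ Fin N) (l : Fin N)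
    (hl : J r r ^ 2 + J r r * (lam l + δ) + lam l * (1 + δ) ≠ 0) :
    R r (Sum.inl l) = 0 ∧ R r (Sum.inr l) = 0 := by
  obtain ⟨b, n, c, e, hJe⟩ := hJ
  have hent : ∀ p q, J (e p) (e q)
      = Matrix.blockDiagonal' (fun i => jordanBlock (c i) (n i)) p q := fun p q => by
    rw [hJe]; simp
  obtain ⟨⟨i, x⟩, rfl⟩ := e.surjective r
  have hdiag : ∀ (x : Fin (n i)), J (e ⟨i, x⟩) (e ⟨i, x⟩) = c i := fun x => by
    rw [hent, Matrix.blockDiagonal'_apply_eq]; simp [jordanBlock]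
  rw [hdiag] at hl
  have hrow : ∀ (x : Fin (n i)) s, (J * R) (e ⟨i, x⟩) s
      = ∑ x' : Fin (n i), jordanBlock (c i) (n i) x x' * R (e ⟨i, x'⟩) s := fun x s => by
    rw [Matrix.mul_apply, ← Equiv.sum_comp e, Fintype.sum_sigma, Finset.sum_eq_single i]
    · simp_rw [hent, Matrix.blockDiagonal'_apply_eq]
    · intro i' _ hi'
      refine Finset.sum_eq_zero fun x' _ => ?_
      rw [hent, Matrix.blockDiagonal'_apply_ne _ _ _ hi'.symm, zero_mul]
    · simp
  -- Induction upwards from the last row of the Jordan block: that row is a genuine left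
  -- eigenvector, and row x involves only itself and row x + 1.
  suffices H : ∀ (k : ℕ) (x : Fin (n i)), n i - x ≤ k →
      R (e ⟨i, x⟩) (Sum.inl l) = 0 ∧ R (e ⟨i, x⟩) (Sum.inr l) = 0 from H _ x le_rfl
  intro k
  induction k with
  | zero => intro x hx; have := x.2; omega
  | succ k ih =>
    intro x hx
    have hstep : ∀ s, (∀ x' : Fin (n i), (x : ℕ) + 1 = x' → R (e ⟨i, x'⟩) s = 0) →
        (R * matP δ lam N) (e ⟨i, x⟩) s = c i * R (e ⟨i, x⟩) s := fun s hs => by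
      rw [hRP, hrow, Finset.sum_eq_single x]
      · simp [jordanBlock]
      · intro x' _ hx'
        by_cases h : (x : ℕ) + 1 = x'
        · rw [hs x' h, mul_zero]
        · simp [jordanBlock, h, hx'.symm]
      · simp
    have h1 := hstep (Sum.inl l) fun x' h => (ih x' (by omega)).1
    have h2 := hstep (Sum.inr l) fun x' h => (ih x' (by omega)).2
    rw [mul_matP_inl] at h1
    rw [mul_matP_inr] at h2
    -- Eliminating the `inl` entry leaves the characteristic polynomial of mode l, at the eigenvalue
    -- of the block, times the `inr` entry.
    have h3 : R (e ⟨i, x⟩) (Sum.inr l) = 0 := by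
      apply (mul_eq_zero.1 (_ : (c i ^ 2 + c i * (lam l + δ) + lam l * (1 + δ)) *
        R (e ⟨i, x⟩) (Sum.inr l) = 0)).resolve_left hl
      linear_combination (-c i) * h2 - h1
    refine ⟨?_, h3⟩
    rw [h3] at h2
    linear_combination h2

open scoped ComplexOrder in
/-- The rank condition provides real right inverses of the blocks of the control matrix that
belong to one eigenvalue. -/
lemma RankCondition.exists_rightInverse {H : Type*} [NormedAddCommGroup H] [InnerProductSpace ℝ H]
    {δ : ℝ} (hδ : 0 < δ) {B : H →L[ℝ] H} {φ : HilbertBasis ℕ ℝ H} {lam : ℕ → ℝ} {N M : ℕ}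
    (h : RankCondition δ B φ lam N M) (k : Fin N) :
    ∃ x : Fin M → ℝ, ∀ j : Fin N, lam j = lam k →
      ∑ i : Fin M, ⟪B (φ i), φ j⟫_ℝ * x i = if j = k then (1 : ℝ) else 0 := by
  obtain ⟨R, J, hR, hP, hJ, hd, -, hrk⟩ := h
  have hRP : R * matP δ lam N = J * R := by
    rw [hP, ← mul_assoc, ← mul_assoc, Matrix.mul_nonsing_inv _ hR, one_mul]
  -- The upper half of Q is zero, so only the `inr` columns of R count, and by `row_support` only
  -- those of the eigenvalue of k.
  set S : Matrix (EigenGroup lam N k) (EigenGroup lam N k) ℂ :=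
    Matrix.of fun j l => R (Sum.inl (j : Fin N)) (Sum.inr (l : Fin N))
  set K : Matrix (EigenGroup lam N k) (Fin M) ℂ :=
    Matrix.of fun j i => ((⟪B (φ i), φ (j : Fin N)⟫_ℝ : ℝ) : ℂ) with hK
  have hmul : (R * matQ B φ N M).conjTranspose.submatrix id
        (fun j : EigenGroup lam N k => Sum.inl (j : Fin N)) = (S * K).conjTranspose := by
    ext i j
    simp only [Matrix.submatrix_apply, Matrix.conjTranspose_apply, id]
    congr 1
    rw [Matrix.mul_apply, Matrix.mul_apply, Fintype.sum_sum_type]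
    simp only [matQ, Matrix.fromRows_apply_inl, Matrix.zero_apply, mul_zero,
      Finset.sum_const_zero, zero_add, Matrix.fromRows_apply_inr, Matrix.of_apply]
    symm
    refine Fintype.sum_of_injective (fun l : EigenGroup lam N k => (l : Fin N))
      Subtype.val_injective _ _ (fun l hl => ?_) (fun l => by simp [S, K])
    have hne : lam l ≠ lam k := fun h => hl ⟨⟨l, h⟩, rfl⟩
    rw [(row_support hRP hJ (Sum.inl (j : Fin N)) l ?_).2, zero_mul]
    rw [hd, j.2]
    intro h0
    refine hne (eq_of_common_root hδ (μ := muPlus δ (lam k)) ?_ (muPlus_root δ (lam k)))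
    linear_combination h0
  -- The `muPlus` half of the rank condition suffices: since S * K has rank m, so does K, which has
  -- m rows.
  have hrank := (hrk k).1
  rw [hmul, Matrix.rank_conjTranspose] at hrank
  have h1 : Fintype.card (EigenGroup lam N k) ≤ K.rank :=
    hrank ▸ Matrix.rank_mul_le_right S K
  have h2 : LinearMap.range K.mulVecLin = ⊤ := by
    apply Submodule.eq_top_of_finrank_eq
    rw [Module.finrank_fintype_fun_eq_card]
    exact le_antisymm (Matrix.rank_le_card_height K) h1
  obtain ⟨z, hz⟩ := LinearMap.range_eq_top.1 h2 (Pi.single ⟨k, rfl⟩ 1)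
  -- K has real entries, so the real part of a complex solution is again a solution.
  refine ⟨fun i => (z i).re, fun j hj => ?_⟩
  have h3 := congrArg Complex.re (congrFun hz ⟨j, hj⟩)
  rw [Matrix.mulVecLin_apply, Matrix.mulVec, dotProduct, Complex.re_sum] at h3
  simp only [hK, Matrix.of_apply, Complex.re_ofReal_mul, Pi.single_apply, Subtype.mk.injEq] at h3
  rw [h3]
  split_ifs <;> simp

end Rank

/-! ### Differential operators with constant coefficients and the control of one mode. -/

section Smooth

open Polynomial

/-- The smooth real functions on the line. -/
def smoothFun : Submodule ℝ (ℝ → ℝ) where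
  carrier := {f | ContDiff ℝ ∞ f}
  add_mem' {f g} hf hg := by
    have hf : ContDiff ℝ ∞ f := hf
    have hg : ContDiff ℝ ∞ g := hg
    exact hf.add hg
  zero_mem' := by
    have : ContDiff ℝ ∞ (0 : ℝ → ℝ) := contDiff_const
    exact this
  smul_mem' c f hf := by
    have hf : ContDiff ℝ ∞ f := hf
    exact hf.const_smul c

lemma differentiable_of_mem (f : smoothFun) : Differentiable ℝ (f : ℝ → ℝ) :=
  (contDiff_infty_iff_deriv.1 f.2).1

/-- Differentiation of smooth functions. -/
def smoothDeriv : Module.End ℝ smoothFun where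
  toFun f := ⟨deriv f, (contDiff_infty_iff_deriv.1 f.2).2⟩
  map_add' f g := by
    ext t
    exact deriv_add (differentiable_of_mem f t) (differentiable_of_mem g t)
  map_smul' c f := by
    ext t
    exact deriv_const_smul c (differentiable_of_mem f t)

lemma smoothDeriv_apply (f : smoothFun) : (smoothDeriv f : ℝ → ℝ) = deriv f := rfl

/-- The smooth functions that vanish near `t`. -/
def zeroNear (t : ℝ) : Submodule ℝ smoothFun where
  carrier := {f | (f : ℝ → ℝ) =ᶠ[𝓝 t] 0}
  add_mem' {f g} hf hg := by
    have := EventuallyEq.add hf hg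
    simpa using this
  zero_mem' := EventuallyEq.rfl
  smul_mem' c f hf := by
    have := EventuallyEq.const_smul hf c
    simpa using this

lemma mem_zeroNear {t : ℝ} {f : smoothFun} : f ∈ zeroNear t ↔ (f : ℝ → ℝ) =ᶠ[𝓝 t] 0 := Iff.rfl

lemma smoothDeriv_mem_zeroNear {t : ℝ} {f : smoothFun} (hf : f ∈ zeroNear t) :
    smoothDeriv f ∈ zeroNear t := by
  have := EventuallyEq.deriv (mem_zeroNear.1 hf)
  rw [mem_zeroNear, smoothDeriv_apply]
  refine this.trans (EventuallyEq.of_eq ?_)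
  ext s
  simp

/-- Differential operators are local. This is how supports are tracked when polynomials in
`smoothDeriv` are applied. -/
lemma aeval_mem_zeroNear {t : ℝ} {f : smoothFun} (hf : f ∈ zeroNear t) (p : ℝ[X]) :
    aeval smoothDeriv p f ∈ zeroNear t := by
  induction p using Polynomial.induction_on generalizing f with
  | C a => simpa using (zeroNear t).smul_mem a hf
  | add p q hp hq => simpa using (zeroNear t).add_mem (hp hf) (hq hf)
  | monomial n a ih =>
    rw [pow_succ, ← mul_assoc, map_mul, Module.End.mul_apply, aeval_X]
    exact ih (smoothDeriv_mem_zeroNear hf)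

/-- The characteristic polynomial of a mode. -/
def modePoly (δ l : ℝ) : ℝ[X] := X ^ 2 + C (l + δ) * X + C (l * (1 + δ))

lemma aeval_modePoly (δ l : ℝ) (f : smoothFun) (t : ℝ) :
    (aeval smoothDeriv (modePoly δ l) f : ℝ → ℝ) t
      = deriv (deriv (f : ℝ → ℝ)) t + (l + δ) * deriv (f : ℝ → ℝ) t + l * (1 + δ) * (f : ℝ → ℝ) t := by
  simp [modePoly, pow_two, smoothDeriv_apply]
  ring

/-- The difference of the two polynomials is (l - k)(X + 1 + δ), while the first equals (X + 1 +
δ)(X + l - 1) + (1 + δ). Eliminating X + 1 + δ gives the explicit Bézout coefficients. -/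
lemma isCoprime_modePoly {δ l k : ℝ} (hδ : 0 < δ) (h : l ≠ k) :
    IsCoprime (modePoly δ l) (modePoly δ k) := by
  have h1 : l - k ≠ 0 := sub_ne_zero.2 h
  have h2 : 1 + δ ≠ 0 := by positivity
  have e1 : (C (1 / (1 + δ)) : ℝ[X]) * C (1 + δ) = 1 := by
    rw [← C_mul, one_div_mul_cancel h2, C_1]
  have e2 : (C (1 / (l - k)) : ℝ[X]) * C (l - k) = 1 := by
    rw [← C_mul, one_div_mul_cancel h1, C_1]
  refine ⟨C (1 / (1 + δ)) * (1 - C (1 / (l - k)) * (X + C (l - 1))),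
    C (1 / (1 + δ)) * C (1 / (l - k)) * (X + C (l - 1)), ?_⟩
  simp only [modePoly, C_add, C_mul, C_sub, C_1] at e1 e2 ⊢
  linear_combination e1 - (C (1 / (1 + δ)) * (X + (C l - 1)) * (X + 1 + C δ)) * e2

/-- A smooth function that satisfies the scalar second order equation gives a mode. -/
lemma isMode_of_modePoly {δ l : ℝ} {f : ℝ → ℝ} {a : ℝ} {g ζ : smoothFun}
    (hg : aeval smoothDeriv (modePoly δ l) ζ = g) (hgf : ∀ t, (g : ℝ → ℝ) t = f t)
    (h0 : (ζ : ℝ → ℝ) 0 = 0) (h1 : deriv (ζ : ℝ → ℝ) 0 = a) :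
    IsMode δ l f a (fun t => deriv (ζ : ℝ → ℝ) t + δ * (ζ : ℝ → ℝ) t) ζ := by
  have hd := differentiable_of_mem ζ
  have hd' := differentiable_of_mem (smoothDeriv ζ)
  rw [smoothDeriv_apply] at hd'
  refine ⟨by simp [h0, h1], h0, ?_, hd.continuous.continuousOn, fun t _ => ?_, fun t _ => ?_⟩
  · have := hd.continuous
    have := hd'.continuous
    fun_prop
  · refine ((hd' t).hasDerivAt.add ((hd t).hasDerivAt.const_mul δ)).congr_deriv ?_
    rw [← hgf, ← hg, aeval_modePoly]
    ring
  · exact (hd t).hasDerivAt.congr_deriv (by ring)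

/-- K is the z component of the free mode started at y = 1, z = 0. It is smooth by bootstrapping,
since y' and z' are linear in y and z. -/
lemma exists_fundamental (δ l : ℝ) : ∃ K : smoothFun, (K : ℝ → ℝ) 0 = 0 ∧ deriv (K : ℝ → ℝ) 0 = 1 ∧
    aeval smoothDeriv (modePoly δ l) K = 0 := by
  obtain ⟨y, z, hy0, hz0, hy, hz⟩ := exists_mode_hasDerivAt δ l (f := fun _ => 0)
    continuous_const 1
  have hy' : deriv y = fun t => 0 - l * (y t + z t) := funext fun t => (hy t).deriv
  have hz' : deriv z = fun t => y t - δ * z t := funext fun t => (hz t).deriv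
  have hs : ∀ n : ℕ, ContDiff ℝ n y ∧ ContDiff ℝ n z := by
    intro n
    induction n with
    | zero =>
      simp only [Nat.cast_zero, contDiff_zero]
      exact ⟨continuous_iff_continuousAt.2 fun t => (hy t).continuousAt,
        continuous_iff_continuousAt.2 fun t => (hz t).continuousAt⟩
    | succ n ih =>
      obtain ⟨h1, h2⟩ := ih
      push_cast
      rw [contDiff_succ_iff_deriv, contDiff_succ_iff_deriv, hy', hz']
      refine ⟨⟨fun t => (hy t).differentiableAt, by simp, ?_⟩,
        ⟨fun t => (hz t).differentiableAt, by simp, ?_⟩⟩ <;> fun_prop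
  refine ⟨⟨z, contDiff_infty.2 fun n => (hs n).2⟩, hz0, ?_, ?_⟩
  · change deriv z 0 = 1
    rw [hz']; simp [hy0, hz0]
  · ext t
    rw [aeval_modePoly]
    change deriv (deriv z) t + (l + δ) * deriv z t + l * (1 + δ) * z t = 0
    have : deriv (deriv z) t = (0 - l * (y t + z t)) - δ * (y t - δ * z t) := by
      conv_lhs => rw [hz']
      exact ((hy t).sub ((hz t).const_mul δ)).deriv
    rw [this, hz']
    ring

/-- Simultaneous null control of finitely many modes by smooth controls supported in `[1, 2]`. -/
lemma exists_control {δ : ℝ} (hδ : 0 < δ) {lam : ℕ → ℝ} {N M : ℕ} (Cm : Fin N → Fin M → ℝ)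
    (k : Fin N) (x : Fin M → ℝ)
    (hx : ∀ j : Fin N, lam j = lam k → ∑ i, Cm j i * x i = if j = k then 1 else 0) :
    ∃ θ : Fin M → smoothFun, (∀ i, ∀ t, t ∉ Icc (1 : ℝ) 2 → θ i ∈ zeroNear t) ∧
      ∀ j : Fin N, ∃ ζ : smoothFun, (∀ t : ℝ, 2 < t → ζ ∈ zeroNear t) ∧ (ζ : ℝ → ℝ) 0 = 0 ∧
        deriv (ζ : ℝ → ℝ) 0 = (if j = k then 1 else 0) ∧
        aeval smoothDeriv (modePoly δ (lam j)) ζ = ∑ i, Cm j i • θ i := by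
  obtain ⟨K, hK0, hK1, hK⟩ := exists_fundamental δ (lam k)
  set T := smoothDeriv with hT
  have hχ : ContDiff ℝ ∞ fun t : ℝ => Real.smoothTransition (2 - t) :=
    Real.smoothTransition.contDiff.comp (contDiff_const.sub contDiff_id)
  -- The cutoff is 1 for t ≤ 1 and 0 for t ≥ 2: κ starts as the free motion K and is at rest after
  -- time 2.
  set κ : smoothFun := ⟨fun t => Real.smoothTransition (2 - t) * (K : ℝ → ℝ) t, hχ.mul K.2⟩ with hκ
  have hκK : ∀ t : ℝ, t < 1 → κ - K ∈ zeroNear t := fun t ht => by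
    rw [mem_zeroNear]
    filter_upwards [eventually_lt_nhds ht] with s hs
    change Real.smoothTransition (2 - s) * (K : ℝ → ℝ) s - (K : ℝ → ℝ) s = 0
    rw [Real.smoothTransition.one_of_one_le (by linarith)]
    ring
  have hκ2 : ∀ t : ℝ, 2 < t → κ ∈ zeroNear t := fun t ht => by
    rw [mem_zeroNear]
    filter_upwards [eventually_gt_nhds ht] with s hs
    change Real.smoothTransition (2 - s) * (K : ℝ → ℝ) s = 0
    rw [Real.smoothTransition.zero_of_nonpos (by linarith)]
    ring
  set p := modePoly δ (lam k)
  -- The control that would realize κ, were mode k alone. It lives on [1, 2] because p annihilates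
  -- K.
  set h := aeval T p κ with hh
  have hsupp : ∀ t, t ∉ Icc (1 : ℝ) 2 → h ∈ zeroNear t := fun t ht => by
    by_cases h1 : t < 1
    · have : h = aeval T p (κ - K) := by rw [map_sub, hK, sub_zero]
      rw [this]
      exact aeval_mem_zeroNear (hκK t h1) p
    · exact aeval_mem_zeroNear (hκ2 t (by by_contra! h2; exact ht ⟨not_lt.1 h1, h2⟩)) p
  set E := (Finset.univ.image fun j : Fin N => lam j).erase (lam k)
  set q := ∏ l ∈ E, modePoly δ l
  -- Here q is the product of the characteristic polynomials of the other eigenvalues. Replacing h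
  -- by (b q) h makes the control a multiple of each of them, at the cost of the correction a h in
  -- the trajectory of mode k.
  obtain ⟨a, b, hab⟩ : IsCoprime p q :=
    IsCoprime.prod_right fun l hl => isCoprime_modePoly hδ (Finset.ne_of_mem_erase hl).symm
  have hmulapp : ∀ (r s : ℝ[X]) (f : smoothFun), aeval T (r * s) f = aeval T r (aeval T s f) :=
    fun r s f => by rw [map_mul, Module.End.mul_apply]
  have hcoef : ∀ j : Fin N, ∑ i, Cm j i • (x i • aeval T (b * q) h)
      = (∑ i, Cm j i * x i) • aeval T (b * q) h := fun j => by
    rw [Finset.sum_smul]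
    exact Finset.sum_congr rfl fun i _ => smul_smul _ _ _
  have h0mem : (0 : ℝ) ∉ Icc (1 : ℝ) 2 := fun h => by linarith [h.1]
  refine ⟨fun i => x i • aeval T (b * q) h, fun i t ht =>
    (zeroNear t).smul_mem _ (aeval_mem_zeroNear (hsupp t ht) _), fun j => ?_⟩
  by_cases hj : lam j = lam k
  -- p(κ - a h) = h - (a p) h = (b q) h by Bézout. Near 0 the correction a h vanishes, so the
  -- initial data are those of K.
  · refine ⟨(if j = k then (1 : ℝ) else 0) • (κ - aeval T a h), fun t ht =>
      (zeroNear t).smul_mem _ ((zeroNear t).sub_mem (hκ2 t ht)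
        (aeval_mem_zeroNear (hsupp t fun h => by linarith [h.2]) _)), ?_, ?_, ?_⟩
    · have h1 := (mem_zeroNear.1 (aeval_mem_zeroNear (hsupp 0 h0mem) a)).eq_of_nhds
      have h2 : (κ : ℝ → ℝ) 0 = 0 := by simp [hκ, hK0]
      split_ifs
      · simp only [one_smul]
        change (κ : ℝ → ℝ) 0 - (aeval T a h : ℝ → ℝ) 0 = 0
        rw [h1, h2]; simp
      · simp
    · split_ifs
      · rw [one_smul]
        have e1 : κ - aeval T a h - K ∈ zeroNear 0 := by
          have : κ - aeval T a h - K = (κ - K) - aeval T a h := by abel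
          rw [this]
          exact (zeroNear 0).sub_mem (hκK 0 one_pos) (aeval_mem_zeroNear (hsupp 0 h0mem) a)
        have e2 : ((κ - aeval T a h : smoothFun) : ℝ → ℝ) =ᶠ[𝓝 0] (K : ℝ → ℝ) := by
          filter_upwards [mem_zeroNear.1 e1] with s hs
          exact sub_eq_zero.1 hs
        rw [e2.deriv_eq, hK1]
      · rw [zero_smul]
        change deriv (fun _ : ℝ => (0 : ℝ)) 0 = 0
        simp
    · rw [hcoef, hx j hj, map_smul, map_sub, hj, ← hmulapp]
      congr 1
      have : aeval T (p * a + b * q) h = h := by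
        rw [mul_comm p a, hab, map_one, Module.End.one_apply]
      rw [map_add, LinearMap.add_apply] at this
      change h - aeval T (p * a) h = _
      rw [sub_eq_iff_eq_add, add_comm]
      exact this.symm
  · have hmem : lam j ∈ E := Finset.mem_erase.2 ⟨hj, Finset.mem_image_of_mem _ (Finset.mem_univ j)⟩
    -- The factor of q belonging to `lam j` is left out; the operator of mode j restores it. This
    -- trajectory starts at rest and is supported in [1, 2].
    set ζ := (∑ i, Cm j i * x i) • aeval T (b * ∏ l ∈ E.erase (lam j), modePoly δ l) h with hζ
    have hz : ∀ t, t ∉ Icc (1 : ℝ) 2 → ζ ∈ zeroNear t := fun t ht =>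
      (zeroNear t).smul_mem _ (aeval_mem_zeroNear (hsupp t ht) _)
    refine ⟨ζ, fun t ht => hz t fun h => by linarith [h.2],
      (mem_zeroNear.1 (hz 0 h0mem)).eq_of_nhds, ?_, ?_⟩
    · rw [if_neg fun h => hj (by rw [h]), (mem_zeroNear.1 (hz 0 h0mem)).deriv_eq]
      simp
    · rw [hcoef, hζ, map_smul, ← hmulapp]
      congr 3
      rw [mul_left_comm, Finset.mul_prod_erase E (modePoly δ) hmem]

end Smooth

/-! ### Superposition: null control of the first modes with bounds. -/

section Control

open Polynomial

lemma exists_bound_of_zeroNear {θ : smoothFun} (h : ∀ t, t ∉ Icc (1 : ℝ) 2 → θ ∈ zeroNear t)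
    (r : ℝ) : ∃ c : ℝ, 0 ≤ c ∧ ∀ t, |(θ : ℝ → ℝ) t| + |(smoothDeriv θ : ℝ → ℝ) t|
      + |(smoothDeriv (smoothDeriv θ) : ℝ → ℝ) t| ≤ c * Real.exp (-r * t) := by
  have h1 := (differentiable_of_mem θ).continuous
  have h2 := (differentiable_of_mem (smoothDeriv θ)).continuous
  have h3 := (differentiable_of_mem (smoothDeriv (smoothDeriv θ))).continuous
  obtain ⟨c, hc⟩ := (isCompact_Icc (a := (1 : ℝ)) (b := 2)).exists_bound_of_continuousOn
    (f := fun t => (|(θ : ℝ → ℝ) t| + |(smoothDeriv θ : ℝ → ℝ) t|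
      + |(smoothDeriv (smoothDeriv θ) : ℝ → ℝ) t|) * Real.exp (r * t)) (by fun_prop)
  have hc0 : 0 ≤ c := (norm_nonneg _).trans (hc 1 (by norm_num))
  refine ⟨c, hc0, fun t => ?_⟩
  by_cases ht : t ∈ Icc (1 : ℝ) 2
  · have h4 := (le_abs_self _).trans (hc t ht)
    have h5 := mul_le_mul_of_nonneg_right h4 (Real.exp_pos (-r * t)).le
    rwa [mul_assoc, ← Real.exp_add, neg_mul, add_neg_cancel, Real.exp_zero, mul_one,
      ← neg_mul] at h5
  · have e1 := h t ht
    have e2 := smoothDeriv_mem_zeroNear e1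
    have e3 := smoothDeriv_mem_zeroNear e2
    rw [(mem_zeroNear.1 e1).eq_of_nhds, (mem_zeroNear.1 e2).eq_of_nhds,
      (mem_zeroNear.1 e3).eq_of_nhds]
    simp
    positivity

lemma abs_sum_smul_le {N : ℕ} (a : Fin N → ℝ) {W : ℝ} (ha : ∀ l, |a l| ≤ W) (g : Fin N → smoothFun)
    (t : ℝ) : |((∑ l, a l • g l : smoothFun) : ℝ → ℝ) t| ≤ ∑ l, W * |(g l : ℝ → ℝ) t| := by
  rw [Submodule.coe_sum, Finset.sum_apply]
  refine (Finset.abs_sum_le_sum_abs _ _).trans (Finset.sum_le_sum fun l _ => ?_)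
  rw [Submodule.coe_smul, Pi.smul_apply, smul_eq_mul, abs_mul]
  exact mul_le_mul_of_nonneg_right (ha l) (abs_nonneg _)

/-- Null control of the first modes, with controls depending linearly on the initial values. -/
lemma exists_nullControl {δ : ℝ} (hδ : 0 < δ) {lam : ℕ → ℝ} {N M : ℕ} (Cm : Fin N → Fin M → ℝ)
    (hx : ∀ k : Fin N, ∃ x : Fin M → ℝ, ∀ j : Fin N, lam j = lam k →
      ∑ i, Cm j i * x i = if j = k then 1 else 0) (r : ℝ) :
    ∃ c : ℝ, 0 ≤ c ∧ ∀ (a : Fin N → ℝ) (W : ℝ), 0 ≤ W → (∀ l, |a l| ≤ W) →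
      ∃ v : Fin M → smoothFun,
        (∀ i t, |(v i : ℝ → ℝ) t| + |(smoothDeriv (v i) : ℝ → ℝ) t|
          + |(smoothDeriv (smoothDeriv (v i)) : ℝ → ℝ) t| ≤ c * W * Real.exp (-r * t)) ∧
        ∀ j : Fin N, ∃ ζ : smoothFun, (∀ t : ℝ, 2 < t → ζ ∈ zeroNear t) ∧ (ζ : ℝ → ℝ) 0 = 0 ∧
          deriv (ζ : ℝ → ℝ) 0 = a j ∧
          aeval smoothDeriv (modePoly δ (lam j)) ζ = ∑ i, Cm j i • v i := by
  choose x hx using hx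
  choose θ hθ ζ hζ2 hζ0 hζ1 hζ using fun k => exists_control hδ Cm k (x k) (hx k)
  choose c hc0 hc using fun k i => exists_bound_of_zeroNear (hθ k i) r
  have hcs : ∀ i, 0 ≤ ∑ l, c l i := fun i => Finset.sum_nonneg fun l _ => hc0 l i
  refine ⟨∑ i, ∑ l, c l i, Finset.sum_nonneg fun i _ => hcs i, fun a W hW ha =>
    ⟨fun i => ∑ l, a l • θ l i, fun i t => ?_, fun j => ⟨∑ l, a l • ζ l j, fun t ht => ?_, ?_, ?_, ?_⟩⟩⟩
  · have e1 := abs_sum_smul_le a ha (fun l => θ l i) t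
    have e2 := abs_sum_smul_le a ha (fun l => smoothDeriv (θ l i)) t
    have e3 := abs_sum_smul_le a ha (fun l => smoothDeriv (smoothDeriv (θ l i))) t
    simp only [map_sum, map_smul]
    have e4 : ∑ l, W * (|(θ l i : ℝ → ℝ) t| + |(smoothDeriv (θ l i) : ℝ → ℝ) t|
      + |(smoothDeriv (smoothDeriv (θ l i)) : ℝ → ℝ) t|) ≤ ∑ l, W * (c l i * Real.exp (-r * t)) :=
      Finset.sum_le_sum fun l _ => mul_le_mul_of_nonneg_left (hc l i t) hW
    simp only [mul_add, Finset.sum_add_distrib] at e4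
    have e5 : ∑ l, W * (c l i * Real.exp (-r * t)) = (∑ l, c l i) * (W * Real.exp (-r * t)) := by
      rw [Finset.sum_mul]; exact Finset.sum_congr rfl fun l _ => by ring
    have e6 : ∑ l, c l i ≤ ∑ i, ∑ l, c l i :=
      Finset.single_le_sum (f := fun i => ∑ l, c l i) (fun i _ => hcs i) (Finset.mem_univ i)
    have e7 := mul_le_mul_of_nonneg_right e6 (mul_nonneg hW (Real.exp_pos (-r * t)).le)
    rw [mul_assoc]
    linarith
  · exact Submodule.sum_mem _ fun l _ => (zeroNear t).smul_mem _ (hζ2 l j t ht)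
  · rw [Submodule.coe_sum, Finset.sum_apply]
    exact Finset.sum_eq_zero fun l _ => by
      rw [Submodule.coe_smul, Pi.smul_apply, hζ0, smul_zero]
  · rw [← smoothDeriv_apply, map_sum, Submodule.coe_sum, Finset.sum_apply]
    simp only [map_smul, Submodule.coe_smul, Pi.smul_apply, smoothDeriv_apply, hζ1]
    simp
  · simp only [map_sum, map_smul, hζ, Finset.smul_sum]
    rw [Finset.sum_comm]
    exact Finset.sum_congr rfl fun i _ => Finset.sum_congr rfl fun l _ => smul_comm _ _ _

end Control

/-! ### Decay of all modes with one constant. -/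

section Decay

/-- A constant of exponential decay that serves all modes, those of the first `N` being assumed to
vanish after time `2`. -/
lemma exists_uniform_decay {δ γ : ℝ} (hδ : 0 < δ) (hγ : γ < δ + 1) {lam : ℕ → ℝ}
    (hlam : Tendsto lam atTop atTop) {N : ℕ}
    (hN : ∀ n, N ≤ n → γ < (muPlus δ (lam n)).re ∧ γ < (muMinus δ (lam n)).re) :
    ∃ C : ℝ, 0 ≤ C ∧ ∀ (n : ℕ) (f : ℝ → ℝ) (a V : ℝ) (y z : ℝ → ℝ), Continuous f → 0 ≤ V →
      IsMode δ (lam n) f a y z → (∀ t, 0 < t → |f t| ≤ V * Real.exp (-(γ + 1) * t)) →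
      (n < N → ∀ t, 2 < t → y t = 0) →
      ∀ t, 0 ≤ t → |y t| ≤ C * (Real.exp (-γ * t) * (|a| + V)) := by
  have hsingle : ∀ n, ∃ C : ℝ, 0 ≤ C ∧ ∀ (f : ℝ → ℝ) (a V : ℝ) (y z : ℝ → ℝ), Continuous f →
      0 ≤ V → IsMode δ (lam n) f a y z → (∀ t, 0 < t → |f t| ≤ V * Real.exp (-(γ + 1) * t)) →
      (n < N → ∀ t, 2 < t → y t = 0) →
      ∀ t, 0 ≤ t → |y t| ≤ C * (Real.exp (-γ * t) * (|a| + V)) := by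
    intro n
    by_cases hn : n < N
    -- A controlled mode may have exponents below γ, so a rate ρ below both is used. Only times up
    -- to 2 matter, and there passing from ρ to γ costs the factor exp(2(γ - ρ)).
    · obtain ⟨ρ, hρ⟩ : ∃ ρ, ρ < min γ (min (muPlus δ (lam n)).re (muMinus δ (lam n)).re) :=
        exists_lt _
      rw [lt_min_iff, lt_min_iff] at hρ
      obtain ⟨C, hC, h⟩ := IsMode.exists_decay hρ.2.1 hρ.2.2
      refine ⟨C * Real.exp (2 * (γ - ρ)), by positivity, ?_⟩
      intro f a V y z hfc hV hm hf h2 t ht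
      by_cases ht2 : 2 < t
      · rw [h2 hn t ht2, abs_zero]; positivity
      · have h3 := h f a V y z hfc hV hm (fun t ht => (hf t ht).trans
          (mul_le_mul_of_nonneg_left (Real.exp_le_exp.2 (by nlinarith)) hV)) t ht
        refine h3.trans ?_
        rw [mul_assoc]
        refine mul_le_mul_of_nonneg_left ?_ hC
        rw [← mul_assoc, ← Real.exp_add]
        refine mul_le_mul_of_nonneg_right (Real.exp_le_exp.2 ?_) (by positivity)
        nlinarith
    · obtain ⟨C, hC, h⟩ := IsMode.exists_decay (hN n (not_lt.1 hn)).1 (hN n (not_lt.1 hn)).2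
      exact ⟨C, hC, fun f a V y z hfc hV hm hf _ => h f a V y z hfc hV hm hf⟩
  choose C hC h using hsingle
  obtain ⟨J, hJ⟩ := eventually_atTop.1 (hlam.eventually_ge_atTop (γ + 2))
  have hs : 0 ≤ ∑ n ∈ Finset.range J, C n := Finset.sum_nonneg fun n _ => hC n
  refine ⟨2 + ∑ n ∈ Finset.range J, C n, by positivity, ?_⟩
  intro n f a V y z hfc hV hm hf h2 t ht
  have hpos : 0 ≤ Real.exp (-γ * t) * (|a| + V) := by positivity
  by_cases hn : n < J
  · have h3 := h n f a V y z hfc hV hm hf h2 t ht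
    have h4 : C n ≤ ∑ n ∈ Finset.range J, C n :=
      Finset.single_le_sum (fun n _ => hC n) (Finset.mem_range.2 hn)
    exact h3.trans (mul_le_mul_of_nonneg_right (by linarith) hpos)
  · obtain ⟨h3, h4⟩ := hm.decay hδ hγ (hJ n (not_lt.1 hn)) hV hf ht
    have h5 : |y t| ≤ |y t + z t| + |z t| := by simpa using abs_sub (y t + z t) (z t)
    have := mul_nonneg hs hpos
    linarith

/-- A supremum in ℕ controls a set only if the set is bounded; `lt_re_of_root` gives this, as large
eigenvalues have roots beyond γ. By the one-based count, an index n in the set would contribute n +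
1 > n. -/
lemma lt_re_of_unstableDim_le {δ γ : ℝ} (hδ : 0 < δ) (hγ : γ < δ + 1) {lam : ℕ → ℝ}
    (hlam : Tendsto lam atTop atTop) {n : ℕ} (hn : unstableDim δ γ lam ≤ n) :
    γ < (muPlus δ (lam n)).re ∧ γ < (muMinus δ (lam n)).re := by
  obtain ⟨J, hJ⟩ := eventually_atTop.1 (hlam.eventually_ge_atTop (γ + 1))
  have key : ∀ μ : ℝ → ℂ, (∀ l : ℝ, μ l ^ 2 - (l + δ) * μ l + l * (1 + δ) = 0) →
      sSup ((fun j : ℕ => j + 1) '' {j | (μ (lam j)).re ≤ γ}) ≤ n → γ < (μ (lam n)).re := by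
    intro μ hμ hs
    by_contra! hle
    have hb : BddAbove ((fun j : ℕ => j + 1) '' {j | (μ (lam j)).re ≤ γ}) := by
      refine ⟨J, ?_⟩
      rintro _ ⟨j, hj, rfl⟩
      by_contra! hlt
      have h1 : (μ (lam j)).re ≤ γ := hj
      exact absurd h1 (not_le.2 (lt_re_of_root hδ hγ (hJ j (by simpa using Nat.lt_succ_iff.1 hlt)) (hμ _)))
    have h2 : n + 1 ≤ _ := le_csSup hb ⟨n, hle, rfl⟩
    have h3 : n + 1 ≤ n := h2.trans hs
    omega
  exact ⟨key _ (muPlus_root δ) ((le_max_left _ _).trans hn),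
    key _ (muMinus_root δ) ((le_max_right _ _).trans hn)⟩

end Decay

/-! ### The memory term and the time integral of a mode. -/

section Convolution

/-- Writing the kernel as exp(-δt) exp(δs) removes t from the integrand. Extending y by its value at
0 to negative times makes the product differentiable everywhere. -/
lemma exp_convolution {δ : ℝ} {y : ℝ → ℝ} (hy : ContinuousOn y (Ici 0)) :
    ContinuousOn (fun t => ∫ s in (0 : ℝ)..t, Real.exp (-δ * (t - s)) * y s) (Ici 0) ∧
    ∀ t, 0 < t → HasDerivAt (fun t => ∫ s in (0 : ℝ)..t, Real.exp (-δ * (t - s)) * y s)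
      (y t - δ * ∫ s in (0 : ℝ)..t, Real.exp (-δ * (t - s)) * y s) t := by
  have hyc : Continuous fun t => y (max t 0) :=
    hy.comp_continuous (by fun_prop) fun t => mem_Ici.2 (le_max_right _ _)
  have hc : Continuous fun s => Real.exp (δ * s) * y (max s 0) :=
    (by fun_prop : Continuous fun s => Real.exp (δ * s)).mul hyc
  set F : ℝ → ℝ := fun t => Real.exp (-δ * t) * ∫ s in (0 : ℝ)..t, Real.exp (δ * s) * y (max s 0)
    with hF
  have hFd : ∀ t, HasDerivAt F (y (max t 0) - δ * F t) t := fun t => by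
    have h1 := (hc.integral_hasStrictDerivAt 0 t).hasDerivAt
    have h2 := ((hasDerivAt_id t).const_mul (-δ)).exp
    refine (h2.mul h1).congr_deriv ?_
    have h3 : Real.exp (-δ * t) * Real.exp (δ * t) = 1 := by rw [← Real.exp_add]; simp
    simp only [id, hF]
    linear_combination (y (max t 0)) * h3
  have heq : ∀ t, 0 ≤ t → ∫ s in (0 : ℝ)..t, Real.exp (-δ * (t - s)) * y s = F t := fun t ht => by
    simp only [hF]
    rw [← intervalIntegral.integral_const_mul]
    refine intervalIntegral.integral_congr fun s hs => ?_
    rw [uIcc_of_le ht] at hs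
    change Real.exp (-δ * (t - s)) * y s = Real.exp (-δ * t) * (Real.exp (δ * s) * y (max s 0))
    rw [max_eq_left hs.1, ← mul_assoc, ← Real.exp_add]
    congr 2; ring
  refine ⟨?_, fun t ht => ?_⟩
  · have : Continuous F := continuous_iff_continuousAt.2 fun t => (hFd t).continuousAt
    exact this.continuousOn.congr fun t ht => heq t ht
  · rw [heq t ht.le]
    have h := hFd t
    rw [max_eq_left ht.le] at h
    refine h.congr_of_eventuallyEq ?_
    filter_upwards [eventually_gt_nhds ht] with s hs using heq s hs.le

/-- Both sides solve x' = y - δx with x(0) = 0, so the first order estimate applies to their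
difference with zero forcing. -/
lemma IsMode.snd_eq_integral {δ l : ℝ} (hδ : 0 < δ) {f : ℝ → ℝ} {a : ℝ} {y z : ℝ → ℝ}
    (h : IsMode δ l f a y z) {t : ℝ} (ht : 0 ≤ t) :
    z t = ∫ s in (0 : ℝ)..t, Real.exp (-δ * (t - s)) * y s := by
  obtain ⟨h1, h2⟩ := exp_convolution (δ := δ) h.cont_fst
  have h3 := abs_le_of_firstOrder (m := δ) (ρ := 0) (G := 0) (g := fun _ => 0)
    (h.cont_snd.sub h1) continuousOn_const
    (fun t ht => ((h.deriv_snd t ht).sub (h2 t ht)).congr_deriv (by simp; ring))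
    (by simp) le_rfl hδ ht
  simp only [Pi.sub_apply, h.init_snd, intervalIntegral.integral_same] at h3
  simp only [sub_self, abs_zero, mul_zero, zero_div, add_zero] at h3
  exact sub_eq_zero.1 (abs_nonpos_iff.1 h3)

/-- The time integral of the square of a mode gains one power of the eigenvalue. -/
lemma IsMode.integral_sq_le {δ γ l : ℝ} (hδ : 0 < δ) (hγ0 : 0 < γ) (hγ : γ < δ + 1)
    (hl : γ + 2 ≤ l) {f : ℝ → ℝ} (hfc : Continuous f) {a V : ℝ} (hV : 0 ≤ V) {y z : ℝ → ℝ}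
    (h : IsMode δ l f a y z)
    (hf : ∀ t, 0 < t → |f t| ≤ V * Real.exp (-(γ + 1) * t)) {T : ℝ} (hT : 0 ≤ T) :
    ∫ t in (0 : ℝ)..T, l * y t ^ 2 ≤ (2 + 2 * (12 * (2 + δ)) ^ 2 * T) * (|a| + V) ^ 2 := by
  set c := 12 * (2 + δ)
  have hl0 : 0 < l := by linarith
  have hl1 : l - 1 ≠ 0 := by linarith
  -- The squared smoothing bound divided by l. Its initial layer 2l exp(-2(l - 1)t) a² has integral
  -- at most l/(l - 1) · a² ≤ 2a², uniformly in l.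
  have hpt : ∀ t ∈ Icc 0 T, l * y t ^ 2
      ≤ 2 * l * Real.exp (-2 * (l - 1) * t) * a ^ 2 + 2 * c ^ 2 * (|a| + V) ^ 2 := by
    intro t ht
    have h1 := (h.smoothing hδ hγ0 hγ hl hfc hV hf ht.1).2
    have h2 := pow_le_pow_left₀ (by positivity) h1 2
    rw [mul_pow, sq_abs] at h2
    have h3 : (l * Real.exp (-(l - 1) * t) * |a| + c * (|a| + V)) ^ 2
        ≤ 2 * (l * Real.exp (-(l - 1) * t) * |a|) ^ 2 + 2 * (c * (|a| + V)) ^ 2 := by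
      nlinarith [sq_nonneg (l * Real.exp (-(l - 1) * t) * |a| - c * (|a| + V))]
    have h4 : Real.exp (-(l - 1) * t) ^ 2 = Real.exp (-2 * (l - 1) * t) := by
      rw [← Real.exp_nat_mul]; congr 1; push_cast; ring
    rw [mul_pow, mul_pow, sq_abs, h4, mul_pow] at h3
    have h5 : l * (l * y t ^ 2) ≤ l * (2 * l * Real.exp (-2 * (l - 1) * t) * a ^ 2
        + 2 * c ^ 2 * (|a| + V) ^ 2) := by
      have : 0 ≤ (l - 1) * (2 * c ^ 2 * (|a| + V) ^ 2) := by
        apply mul_nonneg (by linarith); positivity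
      linarith
    exact le_of_mul_le_mul_left h5 hl0
  have hyc := h.cont_fst.mono (Icc_subset_Ici_self : Icc 0 T ⊆ Ici 0)
  have hint : IntervalIntegrable (fun t => l * y t ^ 2) volume 0 T :=
    ContinuousOn.intervalIntegrable_of_Icc hT (by fun_prop)
  have hd : ∀ t : ℝ, HasDerivAt (fun t => -(l / (l - 1)) * a ^ 2 * Real.exp (-2 * (l - 1) * t)
      + 2 * c ^ 2 * (|a| + V) ^ 2 * t)
      (2 * l * Real.exp (-2 * (l - 1) * t) * a ^ 2 + 2 * c ^ 2 * (|a| + V) ^ 2) t := fun t => by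
    refine ((((hasDerivAt_id t).const_mul (-2 * (l - 1))).exp.const_mul
      (-(l / (l - 1)) * a ^ 2)).add ((hasDerivAt_id t).const_mul
        (2 * c ^ 2 * (|a| + V) ^ 2))).congr_deriv ?_
    simp only [id]
    field_simp
  have hint2 : IntervalIntegrable (fun t => 2 * l * Real.exp (-2 * (l - 1) * t) * a ^ 2
      + 2 * c ^ 2 * (|a| + V) ^ 2) volume 0 T :=
    (by fun_prop : Continuous fun t => 2 * l * Real.exp (-2 * (l - 1) * t) * a ^ 2
      + 2 * c ^ 2 * (|a| + V) ^ 2).intervalIntegrable _ _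
  refine (intervalIntegral.integral_mono_on hT hint hint2 hpt).trans ?_
  rw [intervalIntegral.integral_eq_sub_of_hasDerivAt (fun t _ => hd t) hint2]
  simp only [mul_zero, Real.exp_zero, add_zero, mul_one]
  have h1 : l / (l - 1) ≤ 2 := by rw [div_le_iff₀ (by linarith)]; linarith
  have h0 : 0 ≤ l / (l - 1) := by apply div_nonneg <;> linarith
  have h2 : a ^ 2 ≤ (|a| + V) ^ 2 := by
    rw [← sq_abs a]; exact pow_le_pow_left₀ (abs_nonneg _) (by linarith) 2
  have h3 : 0 ≤ l / (l - 1) * a ^ 2 * Real.exp (-2 * (l - 1) * T) := by positivity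
  have h4 : l / (l - 1) * a ^ 2 ≤ 2 * (|a| + V) ^ 2 := mul_le_mul h1 h2 (sq_nonneg _) (by norm_num)
  linarith

end Convolution

/-! ### Curves with prescribed coordinates, and their integrals. -/

section Curves

variable {H : Type*} [NormedAddCommGroup H] [InnerProductSpace ℝ H]

/-- Almost all coordinates dominated by a square summable sequence: a continuous curve. -/
lemma exists_curve [CompleteSpace H] (φ : HilbertBasis ℕ ℝ H) {c : ℕ → ℝ → ℝ} {S : Set ℝ}
    (hc : ∀ n, ContinuousOn (c n) S) {G : ℕ → ℝ} (hG : Summable fun n => G n ^ 2)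
    (hb : ∀ᶠ n in atTop, ∀ t ∈ S, |c n t| ≤ G n) :
    ∃ Y : ℝ → H, (∀ t ∈ S, ∀ n, ⟪φ n, Y t⟫_ℝ = c n t) ∧ ContinuousOn Y S := by
  have h : ∀ t, ∃ x : H, t ∈ S → ∀ n, ⟪φ n, x⟫_ℝ = c n t := fun t => by
    by_cases ht : t ∈ S
    · obtain ⟨x, hx⟩ := exists_coord φ (c := fun n => c n t) (by
        refine Summable.of_norm_bounded_eventually_nat hG ?_
        filter_upwards [hb] with n hn
        rw [Real.norm_eq_abs, abs_of_nonneg (sq_nonneg _), ← sq_abs]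
        exact pow_le_pow_left₀ (abs_nonneg _) (hn t ht) 2)
      exact ⟨x, fun _ => hx⟩
    · exact ⟨0, fun h => absurd h ht⟩
  choose Y hY using h
  refine ⟨Y, hY, continuousOn_of_coord φ (fun n => (hc n).congr fun t ht => hY t ht n) hG ?_⟩
  filter_upwards [hb] with n hn t ht
  rw [hY t ht n]
  exact hn t ht

/-- The same on the open half line, with a bound on every closed half line inside. -/
lemma exists_curve_Ioi [CompleteSpace H] (φ : HilbertBasis ℕ ℝ H) {c : ℕ → ℝ → ℝ}
    (hc : ∀ n, ContinuousOn (c n) (Ioi 0)) {G : ℝ → ℕ → ℝ}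
    (hG : ∀ ε, 0 < ε → Summable fun n => G ε n ^ 2)
    (hb : ∀ ε, 0 < ε → ∀ᶠ n in atTop, ∀ t, ε ≤ t → |c n t| ≤ G ε n) :
    ∃ Y : ℝ → H, (∀ t, 0 < t → ∀ n, ⟪φ n, Y t⟫_ℝ = c n t) ∧ ContinuousOn Y (Ioi 0) := by
  have h : ∀ t, ∃ x : H, 0 < t → ∀ n, ⟪φ n, x⟫_ℝ = c n t := fun t => by
    by_cases ht : 0 < t
    · obtain ⟨Y, hY, -⟩ := exists_curve φ (S := {t}) (fun n => continuousOn_singleton _ _) (hG t ht)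
        (by filter_upwards [hb t ht] with n hn s hs using hn s (le_of_eq (mem_singleton_iff.1 hs).symm))
      exact ⟨Y t, fun _ => hY t rfl⟩
    · exact ⟨0, fun h => absurd h ht⟩
  choose Y hY using h
  refine ⟨Y, hY, fun t ht => ?_⟩
  have ht0 : 0 < t / 2 := half_pos ht
  have h1 : ContinuousOn Y (Ici (t / 2)) := by
    refine continuousOn_of_coord φ (fun n => ((hc n).mono fun s hs => ?_).congr
      fun s hs => hY s (ht0.trans_le hs) n) (hG _ ht0) ?_
    · exact ht0.trans_le hs
    · filter_upwards [hb _ ht0] with n hn s hs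
      rw [hY s (ht0.trans_le hs) n]
      exact hn s hs
  exact (h1.continuousAt (Ici_mem_nhds (half_lt_self ht))).continuousWithinAt

lemma memLp_two_of_continuousOn {E : Type*} [NormedAddCommGroup E] {Y : ℝ → E} {a b : ℝ} (h : ContinuousOn Y (Icc a b)) :
    MemLp Y 2 (volume.restrict (Ioo a b)) := by
  obtain ⟨C, hC⟩ := isCompact_Icc.exists_bound_of_continuousOn h
  refine MemLp.of_bound ((h.mono Ioo_subset_Icc_self).aestronglyMeasurable measurableSet_Ioo) C ?_
  exact (ae_restrict_mem measurableSet_Ioo).mono fun t ht => hC t (Ioo_subset_Icc_self ht)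

/-- Parseval's identity pointwise in time, then Tonelli to exchange the sum and the integral. -/
lemma memLp_two_of_coord [CompleteSpace H] (φ : HilbertBasis ℕ ℝ H) {Q : ℝ → H} {S : Set ℝ} (hS : MeasurableSet S)
    (hQ : ContinuousOn Q S) (hint : ∀ n, IntegrableOn (fun t => ⟪φ n, Q t⟫_ℝ ^ 2) S)
    {G : ℕ → ℝ} (hG : Summable G) (hb : ∀ᶠ n in atTop, ∫ t in S, ⟪φ n, Q t⟫_ℝ ^ 2 ≤ G n) :
    MemLp Q 2 (volume.restrict S) := by
  have hm : AEStronglyMeasurable Q (volume.restrict S) := hQ.aestronglyMeasurable hS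
  rw [memLp_two_iff_integrable_sq_norm hm]
  refine ⟨(hm.norm.pow 2), ?_⟩
  rw [hasFiniteIntegral_iff_ofReal (Eventually.of_forall fun t => sq_nonneg _)]
  have h1 : ∀ t, ENNReal.ofReal (‖Q t‖ ^ 2) = ∑' n, ENNReal.ofReal (⟪φ n, Q t⟫_ℝ ^ 2) := fun t => by
    rw [← (hasSum_coord_sq φ (Q t)).tsum_eq]
    exact ENNReal.ofReal_tsum_of_nonneg (fun n => sq_nonneg _) (hasSum_coord_sq φ (Q t)).summable
  simp_rw [h1]
  rw [lintegral_tsum fun n => (hint n).aestronglyMeasurable.aemeasurable.ennreal_ofReal]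
  have h2 : ∀ n, 0 ≤ ∫ t in S, ⟪φ n, Q t⟫_ℝ ^ 2 := fun n => integral_nonneg fun t => sq_nonneg _
  have h3 : Summable fun n => ∫ t in S, ⟪φ n, Q t⟫_ℝ ^ 2 := by
    refine Summable.of_norm_bounded_eventually_nat hG ?_
    filter_upwards [hb] with n hn
    rwa [Real.norm_eq_abs, abs_of_nonneg (h2 n)]
  have h4 : ∀ n, ∫⁻ t in S, ENNReal.ofReal (⟪φ n, Q t⟫_ℝ ^ 2)
      = ENNReal.ofReal (∫ t in S, ⟪φ n, Q t⟫_ℝ ^ 2) := fun n =>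
    (ofReal_integral_eq_lintegral_ofReal (hint n) (Eventually.of_forall fun t => sq_nonneg _)).symm
  simp_rw [h4]
  rw [← ENNReal.ofReal_tsum_of_nonneg h2 h3]
  exact ENNReal.ofReal_lt_top

lemma contDiffOn_one_of_hasDerivWithinAt {Y D : ℝ → H} {s : Set ℝ} (hs : UniqueDiffOn ℝ s)
    (h : ∀ t ∈ s, HasDerivWithinAt Y (D t) s t) (hD : ContinuousOn D s) : ContDiffOn ℝ 1 Y s := by
  rw [contDiffOn_one_iff_derivWithin hs]
  exact ⟨fun t ht => (h t ht).differentiableWithinAt,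
    hD.congr fun t ht => (h t ht).derivWithin (hs t ht)⟩

/-- A convolution is determined by its coordinates. -/
lemma integral_smul_eq_of_coord [CompleteSpace H] (φ : HilbertBasis ℕ ℝ H) {δ : ℝ} {Y : ℝ → H} {x : H} {t : ℝ}
    (ht : 0 ≤ t) (hY : ContinuousOn Y (Ici 0))
    (h : ∀ n, ⟪φ n, x⟫_ℝ = ∫ s in (0 : ℝ)..t, Real.exp (-δ * (t - s)) * ⟪φ n, Y s⟫_ℝ) :
    (∫ s in (0 : ℝ)..t, Real.exp (-δ * (t - s)) • Y s) = x ∧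
    ∀ u : H, ∫ s in (0 : ℝ)..t, Real.exp (-δ * (t - s)) * ⟪Y s, u⟫_ℝ = ⟪x, u⟫_ℝ := by
  have hint : IntervalIntegrable (fun s => Real.exp (-δ * (t - s)) • Y s) volume 0 t := by
    apply ContinuousOn.intervalIntegrable_of_Icc ht
    have := hY.mono (Icc_subset_Ici_self : Icc 0 t ⊆ Ici 0)
    fun_prop
  have h1 : ∀ u : H, ∫ s in (0 : ℝ)..t, Real.exp (-δ * (t - s)) * ⟪u, Y s⟫_ℝ
      = ⟪u, ∫ s in (0 : ℝ)..t, Real.exp (-δ * (t - s)) • Y s⟫_ℝ := fun u => by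
    have := (innerSL ℝ u).intervalIntegral_comp_comm hint
    simp only [innerSL_apply_apply, inner_smul_right] at this
    exact this
  have h2 : (∫ s in (0 : ℝ)..t, Real.exp (-δ * (t - s)) • Y s) = x :=
    ext_coord φ fun n => by rw [← h1, h]
  refine ⟨h2, fun u => ?_⟩
  rw [real_inner_comm, ← h2, ← h1]
  simp_rw [real_inner_comm]

end Curves

/-! ### Weak solutions are determined by their modes. -/

section Uniqueness

variable {H : Type*} [NormedAddCommGroup H] [InnerProductSpace ℝ H]
  {A : H →ₗ.[ℝ] H} {φ : HilbertBasis ℕ ℝ H} {lam : ℕ → ℝ} {δ : ℝ} {β : ℝ → ℝ}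
  {f : ℝ → H} {y₀ : H} {y y' : ℝ → H}

/-- Testing the equation with the eigenvector `φ n` turns A w into a multiple of w; the convolution
becomes the second unknown. -/
lemma IsWeakSolution.isMode (hφ : IsEigenbasis A φ lam)
    (hβ : ∀ t, 0 ≤ t → β t = Real.exp (-δ * t)) (h : IsWeakSolution A β f y₀ y) (n : ℕ) :
    IsMode δ (lam n) (fun t => ⟪φ n, f t⟫_ℝ) ⟪φ n, y₀⟫_ℝ (fun t => ⟪φ n, y t⟫_ℝ)
      (fun t => ∫ s in (0 : ℝ)..t, Real.exp (-δ * (t - s)) * ⟪φ n, y s⟫_ℝ) := by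
  have hc : ContinuousOn (fun t => ⟪φ n, y t⟫_ℝ) (Ici 0) := continuousOn_const.inner h.cont
  obtain ⟨h1, h2⟩ := exp_convolution (δ := δ) hc
  refine ⟨by rw [h.init], by simp, hc, h1, fun t ht => ?_, h2⟩
  obtain ⟨hn, he⟩ := hφ.eigen n
  have h3 := h.eqn ⟨φ n, hn⟩ t ht
  simp only [he, inner_smul_right, real_inner_comm (φ n)] at h3
  have h4 : ∫ s in (0 : ℝ)..t, β (t - s) * (lam n * ⟪φ n, y s⟫_ℝ)
      = lam n * ∫ s in (0 : ℝ)..t, Real.exp (-δ * (t - s)) * ⟪φ n, y s⟫_ℝ := by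
    rw [← intervalIntegral.integral_const_mul]
    refine intervalIntegral.integral_congr fun s hs => ?_
    rw [uIcc_of_le ht.le] at hs
    rw [hβ _ (sub_nonneg.2 hs.2)]
    ring
  rw [h4] at h3
  exact h3.congr_deriv (by ring)

lemma IsWeakSolution.unique [CompleteSpace H] (hA : IsAdmissible A) (hφ : IsEigenbasis A φ lam) (hδ : 0 < δ)
    (hβ : ∀ t, 0 ≤ t → β t = Real.exp (-δ * t)) (h : IsWeakSolution A β f y₀ y)
    (h' : IsWeakSolution A β f y₀ y') : EqOn y y' (Ici 0) := fun _ ht =>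
  ext_coord φ fun n =>
    ((h.isMode hφ hβ n).unique hδ (lam_pos hA hφ n).le (h'.isMode hφ hβ n) ht).1

end Uniqueness

/-! ### Construction and regularity of the solution. -/

section Existence

variable {H : Type*} [NormedAddCommGroup H] [InnerProductSpace ℝ H] [CompleteSpace H]
  {A : H →ₗ.[ℝ] H} {φ : HilbertBasis ℕ ℝ H} {lam : ℕ → ℝ} {δ γ : ℝ} {β : ℝ → ℝ}

lemma summable_sq_add {a b : ℕ → ℝ} (ha : Summable fun n => a n ^ 2)
    (hb : Summable fun n => b n ^ 2) : Summable fun n => (a n + b n) ^ 2 := by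
  refine Summable.of_nonneg_of_le (fun n => sq_nonneg _) (fun n => ?_)
    ((ha.mul_left 2).add (hb.mul_left 2))
  nlinarith [sq_nonneg (a n - b n)]

lemma summable_sq_const_mul {a : ℕ → ℝ} (c : ℝ) (ha : Summable fun n => a n ^ 2) :
    Summable fun n => (c * a n) ^ 2 := by
  simpa only [mul_pow] using ha.mul_left (c ^ 2)

/-- Existence and regularity of the solution for a forcing with dominated coordinates. -/
theorem exists_solution (hA : IsAdmissible A) (hφ : IsEigenbasis A φ lam) (hδ : 0 < δ)
    (hβ : ∀ t, 0 ≤ t → β t = Real.exp (-δ * t)) (hγ0 : 0 < γ) (hγ1 : γ < δ + 1)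
    {f : ℝ → H} (hf : Continuous f) {V : ℕ → ℝ} (hV0 : ∀ n, 0 ≤ V n)
    (hV : Summable fun n => V n ^ 2)
    (hfV : ∀ n t, 0 < t → |⟪φ n, f t⟫_ℝ| ≤ V n * Real.exp (-(γ + 1) * t)) (y₀ : H) :
    ∃ Y : ℝ → H, IsWeakSolution A β f y₀ Y ∧ ContDiffOn ℝ 1 Y (Ioi 0) ∧
      (∀ T : ℝ, 0 < T → MemL2Domain (fracPow φ lam (1 / 2)) (Ioo 0 T) Y) ∧
      (∀ a b : ℝ, 0 < a → MemL2Domain A (Ioo a b) Y) ∧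
      (y₀ ∈ A.domain → IsClassicalSolution A β f y₀ Y ∧
        ∀ T : ℝ, 0 < T → ContDiffOn ℝ 1 Y (Icc 0 T)) := by
  have hpos := lam_pos hA hφ
  have hlarge : ∀ᶠ n in atTop, γ + 2 ≤ lam n := (tendsto_lam hA hφ).eventually_ge_atTop _
  have hfc : ∀ n, Continuous fun t => ⟪φ n, f t⟫_ℝ := fun n => continuous_const.inner hf
  choose y z hm using fun n => exists_mode δ (lam n) (hfc n) ⟪φ n, y₀⟫_ℝ
  set G : ℕ → ℝ := fun n => |⟪φ n, y₀⟫_ℝ| + V n with hG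
  have hGs : Summable fun n => G n ^ 2 :=
    summable_sq_add (by simpa only [sq_abs] using (hasSum_coord_sq φ y₀).summable) hV
  have hG0 : ∀ n, 0 ≤ G n := fun n => add_nonneg (abs_nonneg _) (hV0 n)
  set c := 12 * (2 + δ) with hc
  have hc0 : 0 < c := by positivity
  -- bounds for almost all modes
  have hyb : ∀ᶠ n in atTop, ∀ t ∈ Ici (0 : ℝ), |y n t| ≤ 2 * G n := by
    filter_upwards [hlarge] with n hn t ht
    obtain ⟨h1, h2⟩ := (hm n).decay hδ hγ1 hn (hV0 n) (hfV n) ht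
    have h3 : |y n t| ≤ |y n t + z n t| + |z n t| := by simpa using abs_sub (y n t + z n t) (z n t)
    have h4 : Real.exp (-γ * t) * G n ≤ G n := mul_le_of_le_one_left (hG0 n) (by
      rw [Real.exp_le_one_iff]; exact mul_nonpos_of_nonpos_of_nonneg (by linarith) ht)
    linarith
  have hzb : ∀ᶠ n in atTop, ∀ t ∈ Ici (0 : ℝ), |lam n * z n t| ≤ c * G n := by
    filter_upwards [hlarge] with n hn t ht
    have h1 := ((hm n).smoothing hδ hγ0 hγ1 hn (hfc n) (hV0 n) (hfV n) ht).1
    rw [abs_mul, abs_of_pos (hpos n)]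
    have := mul_nonneg (by linarith : 0 ≤ 2 + δ) (hG0 n)
    refine h1.trans ?_
    change 8 * (2 + δ) * G n ≤ _
    rw [hc]; linarith
  have hlyb : ∀ᶠ n in atTop, ∀ t ∈ Ici (0 : ℝ), |lam n * y n t|
      ≤ lam n * Real.exp (-(lam n - 1) * t) * |⟪φ n, y₀⟫_ℝ| + c * G n := by
    filter_upwards [hlarge] with n hn t ht
    have h1 := ((hm n).smoothing hδ hγ0 hγ1 hn (hfc n) (hV0 n) (hfV n) ht).2
    rwa [abs_mul, abs_of_pos (hpos n)]
  have hlyε : ∀ ε, 0 < ε → ∀ᶠ n in atTop, ∀ t, ε ≤ t → |lam n * y n t| ≤ (2 / ε + c) * G n := by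
    intro ε hε
    filter_upwards [hlyb, hlarge] with n hn hl t ht
    have ht0 : 0 ≤ t := hε.le.trans ht
    have h1 := hn t ht0
    -- From x ≤ exp x with x = (λ - 1)t, and λ ≤ 2(λ - 1): away from t = 0 the initial layer is
    -- bounded uniformly in n.
    have h2 : lam n * Real.exp (-(lam n - 1) * t) ≤ 2 / ε := by
      have h3 : (lam n - 1) * t ≤ Real.exp ((lam n - 1) * t) :=
        (by linarith : (lam n - 1) * t ≤ (lam n - 1) * t + 1).trans (Real.add_one_le_exp _)
      rw [neg_mul, Real.exp_neg, ← div_eq_mul_inv, div_le_div_iff₀ (Real.exp_pos _) hε]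
      have h4 : lam n * ε ≤ 2 * ((lam n - 1) * t) := by
        have : (lam n - 1) * ε ≤ (lam n - 1) * t := mul_le_mul_of_nonneg_left ht (by linarith)
        nlinarith
      linarith
    have h5 : |⟪φ n, y₀⟫_ℝ| ≤ G n := le_add_of_nonneg_right (hV0 n)
    have h6 := mul_le_mul h2 h5 (abs_nonneg _) (by positivity)
    linarith
  have hyc := fun n => (hm n).cont_fst
  have hzc := fun n => (hm n).cont_snd
  -- the curves with the coordinates needed
  obtain ⟨Y, hY, hYc⟩ := exists_curve φ hyc (summable_sq_const_mul 2 hGs) hyb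
  obtain ⟨L, hL, hLc⟩ := exists_curve φ (c := fun n t => lam n * z n t) (fun n => continuousOn_const.mul (hzc n))
    (summable_sq_const_mul c hGs) hzb
  obtain ⟨Z, hZ, hZc⟩ := exists_curve φ hzc (summable_sq_const_mul c hGs) (by
    filter_upwards [hzb, hlarge] with n hn hl t ht
    have h1 := hn t ht
    rw [abs_mul, abs_of_pos (hpos n)] at h1
    nlinarith [abs_nonneg (z n t)])
  obtain ⟨W, hW, hWc⟩ := exists_curve_Ioi φ (c := fun n t => lam n * y n t)
    (fun n => continuousOn_const.mul ((hyc n).mono Ioi_subset_Ici_self))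
    (fun ε _ => summable_sq_const_mul (2 / ε + c) hGs) hlyε
  -- X and F stand for A⁻¹Y and A⁻¹f. For general y₀ the derivative of Y need not exist in H at time
  -- 0, whereas X' = F - Y - Z is continuous up to 0.
  obtain ⟨X, hX, hXc⟩ := exists_curve φ (c := fun n t => (lam n)⁻¹ * y n t)
    (fun n => continuousOn_const.mul (hyc n)) (summable_sq_const_mul 2 hGs) (by
      filter_upwards [hyb, hlarge] with n hn hl t ht
      rw [abs_mul, abs_of_pos (inv_pos.2 (hpos n))]
      exact (mul_le_of_le_one_left (abs_nonneg _) (inv_le_one_of_one_le₀ (by linarith))).trans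
        (hn t ht))
  obtain ⟨F, hF, hFc⟩ := exists_curve φ (S := Ici 0) (c := fun n t => (lam n)⁻¹ * ⟪φ n, f t⟫_ℝ)
    (fun n => (continuous_const.mul (hfc n)).continuousOn)
    -- The bound on f is assumed only for t > 0; the second term covers t = 0.
    (G := fun n => V n + |⟪φ n, f 0⟫_ℝ|) (by
      exact summable_sq_add hV
        (by simpa only [sq_abs] using (hasSum_coord_sq φ (f 0)).summable)) (by
      filter_upwards [hlarge] with n hl t ht
      rw [abs_mul, abs_of_pos (inv_pos.2 (hpos n))]
      refine (mul_le_of_le_one_left (abs_nonneg _) (inv_le_one_of_one_le₀ (by linarith))).trans ?_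
      rcases eq_or_lt_of_le (mem_Ici.1 ht) with rfl | ht0
      · linarith [hV0 n]
      · have h1 := hfV n t ht0
        have h2 : Real.exp (-(γ + 1) * t) ≤ 1 := by rw [Real.exp_le_one_iff]; nlinarith
        have h3 := mul_le_of_le_one_right (hV0 n) h2
        linarith [abs_nonneg ⟪φ n, f 0⟫_ℝ])
  have hY0 : Y 0 = y₀ := ext_coord φ fun n => by rw [hY 0 (mem_Ici.2 le_rfl) n, (hm n).init_fst]
  have hconv : ∀ t, 0 ≤ t → ∀ u : H,
      ∫ s in (0 : ℝ)..t, β (t - s) * ⟪Y s, u⟫_ℝ = ⟪Z t, u⟫_ℝ := fun t ht u => by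
    rw [← (integral_smul_eq_of_coord φ (δ := δ) ht hYc (x := Z t) fun n => ?_).2 u]
    · refine intervalIntegral.integral_congr fun s hs => ?_
      rw [uIcc_of_le ht] at hs
      rw [hβ _ (sub_nonneg.2 hs.2)]
    · rw [hZ t ht n, (hm n).snd_eq_integral hδ ht]
      refine intervalIntegral.integral_congr fun s hs => ?_
      rw [uIcc_of_le ht] at hs
      rw [hY s hs.1 n]
  have hYd : ∀ n t, 0 < t → HasDerivAt (fun t => ⟪φ n, Y t⟫_ℝ)
      (⟪φ n, f t⟫_ℝ - lam n * (y n t + z n t)) t := fun n t ht => by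
    refine ((hm n).deriv_fst t ht).congr_of_eventuallyEq ?_
    filter_upwards [eventually_gt_nhds ht] with s hs using hY s hs.le n
  have hYcn : ∀ n, ContinuousOn (fun t => ⟪φ n, Y t⟫_ℝ) (Ici 0) := fun n =>
    continuousOn_const.inner hYc
  refine ⟨Y, ⟨hYc, hY0, fun w t ht => ?_⟩, ?_, fun T hT => ⟨?_, ?_⟩, fun a b ha => ⟨?_, W, ?_, ?_⟩,
    fun hy₀ => ?_⟩
  · -- the weak equation
    have hXg : ∀ t, 0 ≤ t → (X t, Y t) ∈ A.graph := fun t ht => graph_of_coord hA hφ fun n => by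
      rw [hX t ht n, hY t ht n, mul_inv_cancel_left₀ (hpos n).ne']
    have hFg : (F t, f t) ∈ A.graph := graph_of_coord hA hφ fun n => by
      rw [hF t ht.le n, mul_inv_cancel_left₀ (hpos n).ne']
    have hpair : ∀ {x g : H}, (x, g) ∈ A.graph → ⟪g, (w : H)⟫_ℝ = ⟪x, A w⟫_ℝ := fun {x g} h => by
      obtain ⟨u, hu, hu'⟩ := A.mem_graph_iff.1 h
      simp only at hu hu'
      rw [← hu', ← hu]
      exact inner_apply_eq hA u w
    have hXd := hasDerivWithinAt_of_coord φ (Y := X) (Z := fun t => F t - Y t - Z t) (a := 0)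
      (fun n => continuousOn_const.inner hXc) ((hFc.sub hYc).sub hZc) (fun n t ht => by
        have h1 := ((hm n).deriv_fst t ht).const_mul (lam n)⁻¹
        refine (h1.congr_of_eventuallyEq ?_).congr_deriv ?_
        · filter_upwards [eventually_gt_nhds ht] with s hs using hX s hs.le n
        · rw [inner_sub_right, inner_sub_right, hF t ht.le n, hY t ht.le n, hZ t ht.le n]
          have := (hpos n).ne'
          field_simp
          ring) ht.le
    -- By symmetry (Y, w) = (X, A w), so the weak equation is the equation for X paired with A w.
    have hXd' := (hXd.hasDerivAt (Ici_mem_nhds ht)).inner ℝ (hasDerivAt_const t (A w))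
    simp only [inner_zero_right, zero_add] at hXd'
    rw [hconv t ht.le, hpair hFg]
    refine (hXd'.congr_of_eventuallyEq ?_).congr_deriv ?_
    · filter_upwards [eventually_gt_nhds ht] with s hs using hpair (hXg s hs.le)
    · rw [inner_sub_left, inner_sub_left]
  · -- continuous differentiability for positive times
    have hDc : ContinuousOn (fun t => f t - W t - L t) (Ioi 0) :=
      (hf.continuousOn.sub hWc).sub (hLc.mono Ioi_subset_Ici_self)
    refine contDiffOn_one_of_hasDerivWithinAt (uniqueDiffOn_Ioi 0) (fun t ht => ?_) hDc
    have ht0 : 0 < t / 2 := half_pos ht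
    have hsub : Ici (t / 2) ⊆ Ioi 0 := fun s hs => ht0.trans_le hs
    have h1 := hasDerivWithinAt_of_coord φ (Y := Y) (Z := fun t => f t - W t - L t) (a := t / 2)
      (fun n => (hYcn n).mono (hsub.trans Ioi_subset_Ici_self)) (hDc.mono hsub) (fun n s hs => by
        have hs0 := ht0.trans hs
        refine (hYd n s hs0).congr_deriv ?_
        rw [inner_sub_right, inner_sub_right, hW s hs0 n, hL s hs0.le n]
        ring) (half_lt_self ht).le
    exact (h1.hasDerivAt (Ici_mem_nhds (half_lt_self ht))).hasDerivWithinAt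
  · exact memLp_two_of_continuousOn (hYc.mono Icc_subset_Ici_self)
  · -- square integrability in the form domain
    have hsq : ∀ n, lam n ^ (1 / 2 : ℝ) * lam n ^ (1 / 2 : ℝ) = lam n := fun n => by
      rw [← Real.sqrt_eq_rpow, Real.mul_self_sqrt (hpos n).le]
    obtain ⟨Q, hQ, hQc⟩ := exists_curve_Ioi φ (c := fun n t => lam n ^ (1 / 2 : ℝ) * y n t)
      (fun n => continuousOn_const.mul ((hyc n).mono Ioi_subset_Ici_self))
      (fun ε _ => summable_sq_const_mul (2 / ε + c) hGs) (fun ε hε => by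
        filter_upwards [hlyε ε hε, hlarge] with n hn hl t ht
        refine le_trans ?_ (hn t ht)
        rw [abs_mul, abs_mul, abs_of_pos (hpos n), abs_of_pos (Real.rpow_pos_of_pos (hpos n) _)]
        refine mul_le_mul_of_nonneg_right ?_ (abs_nonneg _)
        exact (Real.rpow_le_rpow_of_exponent_le (by linarith) (by norm_num)).trans
          (Real.rpow_one _).le)
    have hQsq : ∀ n, ∀ t ∈ Ioo 0 T, ⟪φ n, Q t⟫_ℝ ^ 2 = lam n * y n t ^ 2 := fun n t ht => by
      rw [hQ t ht.1 n, mul_pow, pow_two, hsq]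
    refine ⟨Q, ?_, (ae_restrict_mem measurableSet_Ioo).mono fun t ht =>
      fracPow_graph_of_coord fun n => by rw [hQ t ht.1 n, hY t ht.1.le n]⟩
    refine memLp_two_of_coord φ measurableSet_Ioo (hQc.mono Ioo_subset_Ioi_self) (fun n => ?_)
      (hGs.mul_left (2 + 2 * c ^ 2 * T)) ?_
    · rw [integrableOn_congr_fun (hQsq n) measurableSet_Ioo]
      refine IntegrableOn.mono_set ?_ Ioo_subset_Icc_self
      have := (hyc n).mono (Icc_subset_Ici_self : Icc 0 T ⊆ Ici 0)
      exact ContinuousOn.integrableOn_Icc (by fun_prop)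
    · filter_upwards [hlarge] with n hl
      rw [setIntegral_congr_fun measurableSet_Ioo (hQsq n), ← integral_Ioc_eq_integral_Ioo,
        ← intervalIntegral.integral_of_le hT.le]
      exact (hm n).integral_sq_le hδ hγ0 hγ1 hl (hfc n) (hV0 n) (hfV n) hT.le
  · exact memLp_two_of_continuousOn (hYc.mono fun t ht => ha.le.trans ht.1)
  · exact memLp_two_of_continuousOn (hWc.mono fun t ht => ha.trans_le ht.1)
  · exact (ae_restrict_mem measurableSet_Ioo).mono fun t ht => graph_of_coord hA hφ fun n => by
      rw [hW t (ha.trans ht.1) n, hY t (ha.trans ht.1).le n]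
  · -- initial values in the domain
    have hly0 : Summable fun n => (lam n * ⟪φ n, y₀⟫_ℝ) ^ 2 := by
      have := (hasSum_coord_sq φ (A ⟨y₀, hy₀⟩)).summable
      simpa only [coord_apply hA hφ] using this
    -- For y₀ in D(A) the initial layer is dominated by |λ (φ n, y₀)|, which is square summable; so
    -- A Y is continuous up to time 0.
    obtain ⟨U, hU, hUc⟩ := exists_curve φ (S := Ici 0) (c := fun n t => lam n * y n t)
      (fun n => continuousOn_const.mul (hyc n)) (G := fun n => |lam n * ⟪φ n, y₀⟫_ℝ| + c * G n)
      (summable_sq_add (by simpa only [sq_abs] using hly0) (summable_sq_const_mul c hGs)) (by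
        filter_upwards [hlyb, hlarge] with n hn hl t ht
        refine (hn t ht).trans (add_le_add_left ?_ _)
        rw [abs_mul, abs_of_pos (hpos n)]
        refine mul_le_mul_of_nonneg_right (mul_le_of_le_one_right (hpos n).le ?_) (abs_nonneg _)
        rw [Real.exp_le_one_iff]
        exact mul_nonpos_of_nonpos_of_nonneg (by linarith) ht)
    have hDc : ContinuousOn (fun t => f t - U t - L t) (Ici 0) :=
      (hf.continuousOn.sub hUc).sub hLc
    have hd : ∀ t, 0 ≤ t → HasDerivWithinAt Y (f t - U t - L t) (Ici 0) t := fun t ht =>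
      hasDerivWithinAt_of_coord φ (Z := fun t => f t - U t - L t) hYcn hDc (fun n s hs => by
        refine (hYd n s hs).congr_deriv ?_
        rw [inner_sub_right, inner_sub_right, hU s hs.le n, hL s hs.le n]
        ring) ht
    refine ⟨⟨hY0, U, hUc, fun t ht => ⟨graph_of_coord hA hφ fun n => by
      rw [hU t ht n, hY t ht n], ?_⟩⟩, fun T hT => ?_⟩
    · have h1 := (integral_smul_eq_of_coord φ (δ := δ) ht hUc (x := L t) fun n => ?_).1
      · have h2 : ∫ s in (0 : ℝ)..t, β (t - s) • U s = L t := by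
          rw [← h1]
          refine intervalIntegral.integral_congr fun s hs => ?_
          rw [uIcc_of_le ht] at hs
          rw [hβ _ (sub_nonneg.2 hs.2)]
        rw [h2]
        exact hd t ht
      · rw [hL t ht n, (hm n).snd_eq_integral hδ ht, ← intervalIntegral.integral_const_mul]
        refine intervalIntegral.integral_congr fun s hs => ?_
        rw [uIcc_of_le ht] at hs
        rw [hU s hs.1 n]
        ring
    · exact contDiffOn_one_of_hasDerivWithinAt (uniqueDiffOn_Icc hT)
        (fun t ht => (hd t ht.1).mono Icc_subset_Ici_self) (hDc.mono Icc_subset_Ici_self)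

end Existence

/-! ### Assembling the decay bound, and derivatives on the closed half line. -/

section Stabilization

lemma summable_sq_sum {ι : Type*} (s : Finset ι) {a : ι → ℕ → ℝ}
    (ha : ∀ i ∈ s, Summable fun n => a i n ^ 2) : Summable fun n => (∑ i ∈ s, a i n) ^ 2 := by
  classical
  induction s using Finset.induction_on with
  | empty => simp
  | insert i s hi ih =>
    simp only [Finset.sum_insert hi]
    exact summable_sq_add (ha i (Finset.mem_insert_self _ _))
      (ih fun j hj => ha j (Finset.mem_insert_of_mem hj))

lemma norm_le_of_coord_le {H : Type*} [NormedAddCommGroup H] [InnerProductSpace ℝ H]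
    [CompleteSpace H] (φ : HilbertBasis ℕ ℝ H) {x y : H} {K c : ℝ} (hK : 0 ≤ K) {g : ℕ → ℝ}
    (hg : Summable fun n => g n ^ 2)
    (h : ∀ n, |⟪φ n, x⟫_ℝ| ≤ K * (|⟪φ n, y⟫_ℝ| + c * ‖y‖ * g n)) :
    ‖x‖ ≤ K * (Real.sqrt (2 + 2 * c ^ 2 * ∑' n, g n ^ 2) * ‖y‖) := by
  have hS : 0 ≤ ∑' n, g n ^ 2 := tsum_nonneg fun n => sq_nonneg _
  have h1 : HasSum (fun n => K ^ 2 * (2 * ⟪φ n, y⟫_ℝ ^ 2 + 2 * (c * ‖y‖) ^ 2 * g n ^ 2))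
      (K ^ 2 * (2 * ‖y‖ ^ 2 + 2 * (c * ‖y‖) ^ 2 * ∑' n, g n ^ 2)) :=
    (((hasSum_coord_sq φ y).mul_left 2).add (hg.hasSum.mul_left _)).mul_left _
  have h2 := hasSum_le (fun n => ?_) (hasSum_coord_sq φ x) h1
  · apply le_of_sq_le_sq _ (by positivity)
    refine h2.trans (le_of_eq ?_)
    rw [mul_pow K, mul_pow (Real.sqrt _), Real.sq_sqrt (by positivity)]
    ring
  · have h3 := pow_le_pow_left₀ (abs_nonneg _) (h n) 2
    rw [sq_abs, mul_pow] at h3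
    refine h3.trans (mul_le_mul_of_nonneg_left ?_ (sq_nonneg K))
    nlinarith [sq_nonneg (|⟪φ n, y⟫_ℝ| - c * ‖y‖ * g n), sq_abs ⟪φ n, y⟫_ℝ]

lemma contDiff_smoothFun (g : smoothFun) (n : ℕ) : ContDiff ℝ n (g : ℝ → ℝ) :=
  contDiff_infty.1 g.2 n

lemma derivWithin_Ici_smoothFun (g : smoothFun) {t : ℝ} (ht : 0 ≤ t) :
    derivWithin (g : ℝ → ℝ) (Ici 0) t = (smoothDeriv g : ℝ → ℝ) t :=
  (differentiable_of_mem g t).derivWithin (uniqueDiffOn_Ici 0 t ht)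

lemma iteratedDerivWithin_Ici_smoothFun (g : smoothFun) {t : ℝ} (ht : 0 ≤ t) :
    iteratedDerivWithin 2 (g : ℝ → ℝ) (Ici 0) t = (smoothDeriv (smoothDeriv g) : ℝ → ℝ) t := by
  rw [iteratedDerivWithin_eq_iteratedDeriv (uniqueDiffOn_Ici 0)
    (contDiff_smoothFun g 2).contDiffAt ht, iteratedDeriv_succ, iteratedDeriv_one]
  rfl

end Stabilization

end PIDE

end

/-! ### The stabilization theorem. -/

theorem mainTheorem5 {H : Type*} [NormedAddCommGroup H] [InnerProductSpace ℝ H] [CompleteSpace H]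
    (A : H →ₗ.[ℝ] H) (hA : PIDE.IsAdmissible A)
    (φ : HilbertBasis ℕ ℝ H) (lam : ℕ → ℝ) (hφ : PIDE.IsEigenbasis A φ lam)
    (B : H →L[ℝ] H)
    (δ : ℝ) (hδ : 0 < δ)
    (β : ℝ → ℝ) (hβ0 : β 0 = 1) (hβc : ContinuousOn β (Set.Ici 0))
    (hβ : ∀ t : ℝ, 0 < t → HasDerivAt β (-(δ * β t)) t)
    (γ : ℝ) (hγ0 : 0 < γ) (hγ1 : γ < δ + 1)
    (N : ℕ) (hN : N = PIDE.unstableDim δ γ lam)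
    (M : ℕ) (hM : M = PIDE.maxMult lam N)
    (hrank : PIDE.RankCondition δ B φ lam N M) :
    ∃ ψ : Fin M → H,
      (PIDE.IsSemisimpleSpectrum δ lam N → ∀ j : Fin M, ψ j = φ j) ∧
      (∀ j : Fin M, ψ j ∈ Submodule.span ℝ (Set.range fun i : Fin M => φ i)) ∧
      ∃ C : ℝ, 0 < C ∧ ∀ y₀ : H, ∃ (v : Fin M → ℝ → ℝ) (y : ℝ → H),
        -- regularity and decay of the control
        (∀ j, ContDiffOn ℝ 2 (v j) (Set.Ici 0)) ∧
        (∀ j, ∀ t : ℝ, 0 ≤ t →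
          |v j t| + |derivWithin (v j) (Set.Ici 0) t|
            + |iteratedDerivWithin 2 (v j) (Set.Ici 0) t|
              ≤ C * Real.exp (-γ * t) * ‖y₀‖) ∧
        -- `y` is the unique solution driven by the control
        PIDE.IsWeakSolution A β (fun t => ∑ i, v i t • B (ψ i)) y₀ y ∧
        (∀ z : ℝ → H, PIDE.IsWeakSolution A β (fun t => ∑ i, v i t • B (ψ i)) y₀ z →
          Set.EqOn z y (Set.Ici 0)) ∧
        -- regularity of the solution
        ContDiffOn ℝ 1 y (Set.Ioi 0) ∧
        (∀ T : ℝ, 0 < T → PIDE.MemL2Domain (PIDE.fracPow φ lam (1 / 2)) (Set.Ioo 0 T) y) ∧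
        (∀ a b : ℝ, 0 < a → a < b → PIDE.MemL2Domain A (Set.Ioo a b) y) ∧
        (y₀ ∈ A.domain →
          PIDE.IsClassicalSolution A β (fun t => ∑ i, v i t • B (ψ i)) y₀ y ∧
          ∀ T : ℝ, 0 < T → ContDiffOn ℝ 1 y (Set.Icc 0 T)) ∧
        -- exponential decay of the solution
        (∀ t : ℝ, 0 ≤ t → ‖y t‖ ≤ C * Real.exp (-γ * t) * ‖y₀‖) := by
  subst hN
  set N := PIDE.unstableDim δ γ lam with hNdef
  have hβe : ∀ t, 0 ≤ t → β t = Real.exp (-δ * t) := fun t ht =>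
    PIDE.eqOn_exp_of_hasDerivAt hβ0 hβc hβ ht
  have hlam := PIDE.tendsto_lam hA hφ
  -- The rate γ + 1 leaves the margin over γ that the decay and smoothing estimates require of the
  -- forcing.
  obtain ⟨c, hc0, hctrl⟩ := PIDE.exists_nullControl hδ (lam := lam) (N := N) (M := M)
    (fun j i => ⟪B (φ i), φ j⟫_ℝ) (fun k => hrank.exists_rightInverse hδ k) (γ + 1)
  obtain ⟨D, hD0, hD⟩ := PIDE.exists_uniform_decay (N := N) hδ hγ1 hlam
    fun n hn => PIDE.lt_re_of_unstableDim_le hδ hγ1 hlam hn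
  set g : ℕ → ℝ := fun n => ∑ i : Fin M, |⟪φ n, B (φ i)⟫_ℝ| with hg
  have hg0 : ∀ n, 0 ≤ g n := fun n => Finset.sum_nonneg fun i _ => abs_nonneg _
  have hgs : Summable fun n => g n ^ 2 := PIDE.summable_sq_sum _ fun i _ => by
    simpa only [sq_abs] using (PIDE.hasSum_coord_sq φ (B (φ i))).summable
  set S := Real.sqrt (2 + 2 * c ^ 2 * ∑' n, g n ^ 2) with hS
  have hS0 : 0 ≤ S := Real.sqrt_nonneg _
  -- In the constant, c bounds the controls, D * S bounds the state, and 1 ensures positivity.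
  refine ⟨fun i => φ i, fun _ _ => rfl, fun j => Submodule.subset_span ⟨j, rfl⟩,
    c + D * S + 1, by positivity, fun y₀ => ?_⟩
  have hcoord : ∀ n, |⟪φ n, y₀⟫_ℝ| ≤ ‖y₀‖ := fun n => by
    simpa [φ.orthonormal.1 n] using abs_real_inner_le_norm (φ n) y₀
  obtain ⟨v, hv, hζ⟩ := hctrl (fun l => ⟪φ l, y₀⟫_ℝ) ‖y₀‖ (norm_nonneg _) fun l => hcoord l
  set f : ℝ → H := fun t => ∑ i, (v i : ℝ → ℝ) t • B (φ i) with hf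
  have hfc : Continuous f := continuous_finsetSum _ fun i _ =>
    (PIDE.differentiable_of_mem (v i)).continuous.smul continuous_const
  have hfn : ∀ n t, ⟪φ n, f t⟫_ℝ = ∑ i, (v i : ℝ → ℝ) t * ⟪φ n, B (φ i)⟫_ℝ := fun n t => by
    simp only [hf, inner_sum, inner_smul_right]
  have hfV : ∀ n t, 0 < t → |⟪φ n, f t⟫_ℝ| ≤ c * ‖y₀‖ * g n * Real.exp (-(γ + 1) * t) := by
    intro n t _
    rw [hfn, hg, Finset.mul_sum, Finset.sum_mul]
    refine (Finset.abs_sum_le_sum_abs _ _).trans (Finset.sum_le_sum fun i _ => ?_)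
    rw [abs_mul, mul_right_comm]
    refine mul_le_mul_of_nonneg_right (le_trans ?_ (hv i t)) (abs_nonneg _)
    rw [add_assoc]
    exact le_add_of_nonneg_right (by positivity)
  have hV0 : ∀ n, 0 ≤ c * ‖y₀‖ * g n := fun n => mul_nonneg (by positivity) (hg0 n)
  obtain ⟨Y, hweak, hC1, hhalf, hdom, hclass⟩ := PIDE.exists_solution hA hφ hδ hβe hγ0 hγ1 hfc hV0
    (PIDE.summable_sq_const_mul _ hgs) hfV y₀
  refine ⟨fun i => v i, Y, fun i => (PIDE.contDiff_smoothFun (v i) 2).contDiffOn,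
    fun i t ht => ?_, hweak, fun z hz => hz.unique hA hφ hδ hβe hweak, hC1, hhalf,
    fun a b ha _ => hdom a b ha, hclass, fun t ht => ?_⟩
  · rw [PIDE.derivWithin_Ici_smoothFun _ ht, PIDE.iteratedDerivWithin_Ici_smoothFun _ ht]
    refine (hv i t).trans ?_
    have h1 : Real.exp (-(γ + 1) * t) ≤ Real.exp (-γ * t) := Real.exp_le_exp.2 (by linarith)
    have h2 : c ≤ c + D * S + 1 := by linarith [mul_nonneg hD0 hS0]
    rw [mul_right_comm]
    exact mul_le_mul_of_nonneg_right (mul_le_mul h2 h1 (Real.exp_pos _).le (hc0.trans h2))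
      (norm_nonneg _)
  · have hmode := hweak.isMode hφ hβe
    -- By uniqueness of the mode, the coordinate of Y is ζ' + δζ for the trajectory ζ built with the
    -- control, which vanishes after time 2.
    have hvanish : ∀ n < N, ∀ t, 2 < t → ⟪φ n, Y t⟫_ℝ = 0 := by
      intro n hn t ht
      obtain ⟨ζ, hζ2, hζ0, hζ1, hζP⟩ := hζ ⟨n, hn⟩
      have hm := PIDE.isMode_of_modePoly (f := fun t => ⟪φ n, f t⟫_ℝ) hζP (fun s => by
        rw [Submodule.coe_sum, Finset.sum_apply, hfn]
        refine Finset.sum_congr rfl fun i _ => ?_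
        rw [Submodule.coe_smul, Pi.smul_apply, smul_eq_mul, mul_comm, real_inner_comm]) hζ0 hζ1
      have h1 := ((hmode n).unique hδ (PIDE.lam_pos hA hφ n).le hm (by linarith : 0 ≤ t)).1
      have h2 := PIDE.mem_zeroNear.1 (hζ2 t ht)
      rw [h1, h2.eq_of_nhds, h2.deriv_eq]
      simp
    have hb : ∀ n, |⟪φ n, Y t⟫_ℝ|
        ≤ D * Real.exp (-γ * t) * (|⟪φ n, y₀⟫_ℝ| + c * ‖y₀‖ * g n) := fun n => by
      rw [mul_assoc]
      exact hD n _ _ _ _ _ (continuous_const.inner hfc) (hV0 n) (hmode n) (hfV n) (hvanish n) t ht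
    refine (PIDE.norm_le_of_coord_le φ (by positivity) hgs hb).trans ?_
    rw [← hS]
    have h1 : D * S ≤ c + D * S + 1 := by linarith
    have h2 := mul_le_mul_of_nonneg_right h1
      (mul_nonneg (Real.exp_pos (-γ * t)).le (norm_nonneg y₀))
    linarith
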